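/- Let $(X,J)$ be a complex manifold of complex dimension $n$ with a smooth Hermitian metric $g$, let $\omega(\cdot,\cdot)=g(\cdot,J\,\cdot)$ be its fundamental form, and let $d^c=-J^{-1}dJ$, where $J$ acts on $k$-forms by $(J\alpha)(v_1,\dots,v_k)=\alpha(J^{-1}v_1,\dots,J^{-1}v_k)$. Let $\nabla^{LC}$ be the Levi-Civita connection of $g$, and let $\nabla^B$ be the Bismut connection of $(J,g)$, i.e. the unique connection with $\nabla^B g=0$ and $\nabla^B J=0$ whose torsion $T^B(x,y,z):=g(T^B(x,y),z)$, $T^B(x,y)=\nabla^B_xy-\nabla^B_yx-[x,y]$, is totally skew-symmetric. Let $R^B(x,y)z=\nabla^B_x\nabla^B_yz-\nabla^B_y\nabla^B_xz-\nabla^B_{[x,y]}z$ be its curvature, and assume that $\nabla^B$ satisfies the first Bianchi identity $$R^B(x,y)z+R^B(y,z)x+R^B(z,x)y=0 .$$ 1. If $g$ is SKT, i.e. $dT^B=0$, then $\nabla^{LC}T^B=0$. 2. If $n=2$ and $g$ is Gauduchon, i.e. $dd^c\omega^{n-1}=0$, then $g$ is Vaisman, i.e. there is a smooth $1$-form $\theta$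 with $d\omega=\theta\wedge\omega$, $d\theta=0$ and $\nabla^{LC}\theta=0$. -/

import Mathlib

open Bundle
open scoped Manifold ContDiff

/-! ### Complex manifolds as real manifolds

A complex manifold is a manifold `M` modelled on a finite-dimensional complex normed space `E`,
with holomorphic transition maps: `IsManifold 𝓘(ℂ, E) ω M`. Its real tangent space at `x` is
`TangentSpace 𝓘(ℝ, E) x`, which Mathlib identifies with `E` through the preferred chart at `x`. -/

section RealStructure

/-- A complex manifold is a real-analytic (in particular smooth) real manifold. -/
instance realStructureOfComplex {E : Type*} [NormedAddCommGroup E] [NormedSpace ℂ E]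
    {M : Type*} [TopologicalSpace M] [ChartedSpace E M] [h : IsManifold 𝓘(ℂ, E) ω M] :
    IsManifold 𝓘(ℝ, E) ω M := by
  refine isManifold_of_contDiffOn 𝓘(ℝ, E) ω M fun e e' he he' => ?_
  have key := (contDiffGroupoid ω 𝓘(ℂ, E)).compatible he he'
  rw [contDiffGroupoid, mem_groupoid_of_pregroupoid] at key
  exact key.1.restrict_scalars ℝ

end RealStructure

noncomputable section

namespace Hermitian

variable {E : Type*} [NormedAddCommGroup E] [NormedSpace ℂ E]
  {M : Type*} [TopologicalSpace M] [ChartedSpace E M]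

/-! ### The complex structure, differential forms, `d`, `∧` and `d^c` -/

/-- The complex structure `J` on the real tangent space `T_x M`: multiplication by `i` in a
holomorphic chart (the result does not depend on the chart). -/
def J (x : M) : TangentSpace 𝓘(ℝ, E) x →L[ℝ] TangentSpace 𝓘(ℝ, E) x :=
  (Complex.I • ContinuousLinearMap.id ℝ E : E →L[ℝ] E)

lemma J_J (x : M) (v : TangentSpace 𝓘(ℝ, E) x) : J x (J x v) = -v := by
  have h : ∀ w : E, Complex.I • Complex.I • w = -w := fun w => by
    rw [smul_smul, Complex.I_mul_I, neg_one_smul]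
  exact h v

variable (E M) in
/-- Real differential forms of degree `k` on `M` (no regularity imposed). -/
abbrev Form (k : ℕ) : Type _ :=
  Π x : M, (TangentSpace 𝓘(ℝ, E) x) [⋀^Fin k]→L[ℝ] ℝ

/-- The expression of a `k`-form in the preferred chart at `x`: its pull-back under the inverse of
that chart. -/
def inChart {k : ℕ} (α : Form E M k) (x : M) (y : E) : E [⋀^Fin k]→L[ℝ] ℝ :=
  (α ((extChartAt 𝓘(ℝ, E) x).symm y)).compContinuousLinearMap
    (mfderiv 𝓘(ℝ, E) 𝓘(ℝ, E) (extChartAt 𝓘(ℝ, E) x).symm y)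

/-- A differential form is smooth if all its chart expressions are. -/
def IsSmoothForm {k : ℕ} (α : Form E M k) : Prop :=
  ∀ x : M, ContDiffOn ℝ ∞ (inChart α x) (extChartAt 𝓘(ℝ, E) x).target

/-- The exterior derivative of a differential form. -/
def d {k : ℕ} (α : Form E M k) : Form E M (k + 1) := fun x =>
  (extDeriv (inChart α x) (extChartAt 𝓘(ℝ, E) x x)).compContinuousLinearMap
    (mfderiv 𝓘(ℝ, E) 𝓘(ℝ, E) (extChartAt 𝓘(ℝ, E) x) x)

/-- The action of `J` on forms: `(J α)(v₁, …, v_k) = α(J⁻¹ v₁, …, J⁻¹ v_k)`, with `J⁻¹ = -J`. -/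
def formJ {k : ℕ} (α : Form E M k) : Form E M k := fun x =>
  (α x).compContinuousLinearMap (-J x)

/-- The inverse of the action of `J` on forms: `(J⁻¹ α)(v₁, …, v_k) = α(J v₁, …, J v_k)`. -/
def formJInv {k : ℕ} (α : Form E M k) : Form E M k := fun x =>
  (α x).compContinuousLinearMap (J x)

/-- The operator `d^c = -J⁻¹ d J`. -/
def dc {k : ℕ} (α : Form E M k) : Form E M (k + 1) := fun x => -formJInv (d (formJ α)) x

/-- The tensor product of two alternating forms, as a multilinear form. -/
def tensor {V : Type*} [AddCommGroup V] [Module ℝ V] [TopologicalSpace V] {k l : ℕ}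
    (a : V [⋀^Fin k]→L[ℝ] ℝ) (b : V [⋀^Fin l]→L[ℝ] ℝ) :
    ContinuousMultilinearMap ℝ (fun _ : Fin (k + l) => V) ℝ where
  toFun v := a (fun i => v (Fin.castAdd l i)) * b (fun j => v (Fin.natAdd k j))
  map_update_add' := by
    intro inst v i x y
    obtain rfl : inst = instDecidableEqFin _ := Subsingleton.elim _ _
    refine Fin.addCases (fun i => ?_) (fun i => ?_) i
    · have h1 : ∀ z, (fun j => Function.update v (Fin.castAdd l i) z (Fin.castAdd l j)) =
          Function.update (fun j => v (Fin.castAdd l j)) i z := fun z =>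
        Function.update_comp_eq_of_injective v (Fin.castAdd_injective k l) i z
      have h2 : ∀ z, (fun j => Function.update v (Fin.castAdd l i) z (Fin.natAdd k j)) =
          fun j => v (Fin.natAdd k j) := fun z => by
        funext j
        exact Function.update_of_ne (by simp [Fin.ext_iff]; omega) _ _
      simp only [h1, h2, a.map_update_add, add_mul]
    · have h1 : ∀ z, (fun j => Function.update v (Fin.natAdd k i) z (Fin.natAdd k j)) =
          Function.update (fun j => v (Fin.natAdd k j)) i z := fun z =>
        Function.update_comp_eq_of_injective v (Fin.natAdd_injective l k) i z
      have h2 : ∀ z, (fun j => Function.update v (Fin.natAdd k i) z (Fin.castAdd l j)) =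
          fun j => v (Fin.castAdd l j) := fun z => by
        funext j
        exact Function.update_of_ne (by simp [Fin.ext_iff]; omega) _ _
      simp only [h1, h2, b.map_update_add, mul_add]
  map_update_smul' := by
    intro inst v i c x
    obtain rfl : inst = instDecidableEqFin _ := Subsingleton.elim _ _
    refine Fin.addCases (fun i => ?_) (fun i => ?_) i
    · have h1 : ∀ z, (fun j => Function.update v (Fin.castAdd l i) z (Fin.castAdd l j)) =
          Function.update (fun j => v (Fin.castAdd l j)) i z := fun z =>
        Function.update_comp_eq_of_injective v (Fin.castAdd_injective k l) i z
      have h2 : ∀ z, (fun j => Function.update v (Fin.castAdd l i) z (Fin.natAdd k j)) =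
          fun j => v (Fin.natAdd k j) := fun z => by
        funext j
        exact Function.update_of_ne (by simp [Fin.ext_iff]; omega) _ _
      simp only [h1, h2, a.map_update_smul, smul_eq_mul, mul_assoc]
    · have h1 : ∀ z, (fun j => Function.update v (Fin.natAdd k i) z (Fin.natAdd k j)) =
          Function.update (fun j => v (Fin.natAdd k j)) i z := fun z =>
        Function.update_comp_eq_of_injective v (Fin.natAdd_injective l k) i z
      have h2 : ∀ z, (fun j => Function.update v (Fin.natAdd k i) z (Fin.castAdd l j)) =
          fun j => v (Fin.castAdd l j) := fun z => by
        funext j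
        exact Function.update_of_ne (by simp [Fin.ext_iff]; omega) _ _
      simp only [h1, h2, b.map_update_smul, smul_eq_mul, mul_left_comm]
  cont :=
    (a.cont.comp (continuous_pi fun i => continuous_apply (Fin.castAdd l i))).mul
      (b.cont.comp (continuous_pi fun j => continuous_apply (Fin.natAdd k j)))

/-- The wedge product, normalised by
`(α ∧ β)(v) = (1 / (k! l!)) ∑_σ sign σ α(v_{σ 1}, …, v_{σ k}) β(v_{σ (k+1)}, …, v_{σ (k+l)})`. -/
def wedge {k l : ℕ} (α : Form E M k) (β : Form E M l) : Form E M (k + l) := fun x =>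
  ((k.factorial * l.factorial : ℝ))⁻¹ •
    ContinuousMultilinearMap.alternatization (tensor (α x) (β x))

/-- The power `α^k = α ∧ ⋯ ∧ α` of a `2`-form, with `α^0 = 1`. -/
def wedgePow (α : Form E M 2) : (k : ℕ) → Form E M (2 * k)
  | 0 => fun x => ContinuousAlternatingMap.constOfIsEmpty ℝ (TangentSpace 𝓘(ℝ, E) x) (Fin 0) 1
  | k + 1 => wedge (wedgePow α k) α

/-! ### Vector fields and connections -/

section Connections

variable [FiniteDimensional ℂ E] [IsManifold 𝓘(ℂ, E) ω M]

variable (E M) in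
/-- Vector fields on `M` (no regularity imposed). -/
abbrev VField : Type _ := Π x : M, TangentSpace 𝓘(ℝ, E) x

/-- A vector field is differentiable at `x`. -/
def DiffAt (Y : VField E M) (x : M) : Prop :=
  MDifferentiableAt 𝓘(ℝ, E) (𝓘(ℝ, E).prod 𝓘(ℝ, E))
    (fun y => (⟨y, Y y⟩ : TangentBundle 𝓘(ℝ, E) M)) x

/-- A vector field is smooth at `x`. -/
def SmoothAt (Y : VField E M) (x : M) : Prop :=
  ContMDiffAt 𝓘(ℝ, E) (𝓘(ℝ, E).prod 𝓘(ℝ, E)) ∞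
    (fun y => (⟨y, Y y⟩ : TangentBundle 𝓘(ℝ, E) M)) x

variable (E M) in
/-- Affine connections on `M`: covariant derivatives on the tangent bundle. For such a `D`, the
vector `D Y x v` is `∇_v Y` at `x`. -/
abbrev Connection : Type _ :=
  CovariantDerivative 𝓘(ℝ, E) E (fun x : M => TangentSpace 𝓘(ℝ, E) x)

/-- The curvature `R(X, Y) Z = ∇_X ∇_Y Z - ∇_Y ∇_X Z - ∇_[X, Y] Z` at `x`. -/
def curvature (D : Connection E M) (X Y Z : VField E M) (x : M) : TangentSpace 𝓘(ℝ, E) x :=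
  D (fun y => D Z y (Y y)) x (X x) - D (fun y => D Z y (X y)) x (Y x)
    - D Z x (VectorField.mlieBracket 𝓘(ℝ, E) X Y x)

/-- The first Bianchi identity: the cyclic sum of `R(X, Y) Z` vanishes. -/
def FirstBianchi (D : Connection E M) : Prop :=
  ∀ (x : M) (X Y Z : VField E M), SmoothAt X x → SmoothAt Y x → SmoothAt Z x →
    curvature D X Y Z x + curvature D Y Z X x + curvature D Z X Y x = 0

/-- `∇ α = 0` for a differential form `α`, where
`(∇_v α)(Y₁, …, Y_k) = v(α(Y₁, …, Y_k)) - ∑ i, α(Y₁, …, ∇_v Y_i, …, Y_k)`. -/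
def IsParallel (D : Connection E M) {k : ℕ} (α : Form E M k) : Prop :=
  ∀ (x : M) (Y : Fin k → VField E M), (∀ i, DiffAt (Y i) x) →
    ∀ v : TangentSpace 𝓘(ℝ, E) x,
      mvfderiv 𝓘(ℝ, E) (fun y => α y (fun i => Y i y)) x v
        - ∑ i, α x (Function.update (fun j => Y j x) i (D (Y i) x v)) = 0

end Connections

/-! ### Hermitian metrics -/

set_option linter.unusedSectionVars false

section Metrics

variable [FiniteDimensional ℂ E] [IsManifold 𝓘(ℂ, E) ω M]

variable (E M) in
/-- Smooth Riemannian metrics on `M`. -/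
abbrev Metric : Type _ :=
  ContMDiffRiemannianMetric 𝓘(ℝ, E) ∞ E (fun x : M => TangentSpace 𝓘(ℝ, E) x)

/-- A Riemannian metric is Hermitian if `J` is isometric. -/
def IsHermitian (g : Metric E M) : Prop :=
  ∀ (x : M) (v w : TangentSpace 𝓘(ℝ, E) x), g.inner x (J x v) (J x w) = g.inner x v w

lemma IsHermitian.inner_J_self {g : Metric E M} (hg : IsHermitian g) (x : M)
    (v : TangentSpace 𝓘(ℝ, E) x) : g.inner x v (J x v) = 0 := by
  have h := hg x v (J x v)
  rw [J_J, map_neg, g.symm x (J x v) v] at h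
  linarith

lemma continuous_inner {X : Type*} [TopologicalSpace X] (g : Metric E M) (x : M)
    {a b : X → TangentSpace 𝓘(ℝ, E) x} (ha : Continuous a) (hb : Continuous b) :
    Continuous fun t => g.inner x (a t) (b t) := by
  let B : E →L[ℝ] E →L[ℝ] ℝ := g.inner x
  let a' : X → E := a
  let b' : X → E := b
  have ha' : Continuous a' := ha
  have hb' : Continuous b' := hb
  exact (B.continuous.comp ha').clm_apply hb'

lemma continuous_torsion {X : Type*} [TopologicalSpace X] (D : Connection E M) (x : M)
    {a b : X → TangentSpace 𝓘(ℝ, E) x} (ha : Continuous a) (hb : Continuous b) :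
    Continuous fun t => D.torsion x (a t) (b t) := by
  let B : E →L[ℝ] E →L[ℝ] E := D.torsion x
  let a' : X → E := a
  let b' : X → E := b
  have ha' : Continuous a' := ha
  have hb' : Continuous b' := hb
  exact (B.continuous.comp ha').clm_apply hb'

/-- The fundamental form `ω(v, w) = g(v, J w)` of a Hermitian metric. -/
def fundamentalForm {g : Metric E M} (hg : IsHermitian g) : Form E M 2 := fun x =>
  { toFun := fun v => g.inner x (v 0) (J x (v 1))
    map_update_add' := by
      intro inst v i y z
      obtain rfl : inst = instDecidableEqFin _ := Subsingleton.elim _ _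
      fin_cases i <;> simp
    map_update_smul' := by
      intro inst v i c z
      obtain rfl : inst = instDecidableEqFin _ := Subsingleton.elim _ _
      fin_cases i <;> simp
    cont := continuous_inner g x (continuous_apply 0) ((J x).continuous.comp (continuous_apply 1))
    map_eq_zero_of_eq' := by
      intro v i j hv hij
      have h : v 0 = v 1 := by
        fin_cases i <;> fin_cases j <;> simp_all
      show g.inner x (v 0) (J x (v 1)) = 0
      rw [h]
      exact hg.inner_J_self x (v 1) }

/-- `∇ g = 0`. -/
def IsMetric (g : Metric E M) (D : Connection E M) : Prop :=
  ∀ (x : M) (Y Z : VField E M), DiffAt Y x → DiffAt Z x → ∀ v : TangentSpace 𝓘(ℝ, E) x,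
    mvfderiv 𝓘(ℝ, E) (fun y => g.inner y (Y y) (Z y)) x v =
      g.inner x (D Y x v) (Z x) + g.inner x (Y x) (D Z x v)

/-- `∇ J = 0`. -/
def IsComplex (D : Connection E M) : Prop :=
  ∀ (x : M) (Y : VField E M), DiffAt Y x → ∀ v : TangentSpace 𝓘(ℝ, E) x,
    D (fun y => J y (Y y)) x v = J x (D Y x v)

/-- `D` is the Levi-Civita connection of `g`: it is smooth, metric and torsion-free. -/
structure IsLeviCivita (g : Metric E M) (D : Connection E M) : Prop where
  smooth : D.ContMDiffCovariantDerivative ∞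
  metric : IsMetric g D
  torsion : D.torsion = 0

/-- `D` is the Bismut connection of the Hermitian metric `g`: it is smooth and Hermitian
(`∇ g = 0` and `∇ J = 0`), and its torsion `T(u, v, w) = g(T(u, v), w)` is totally
skew-symmetric (it is always skew-symmetric in `u, v`). -/
structure IsBismut (g : Metric E M) (D : Connection E M) : Prop where
  smooth : D.ContMDiffCovariantDerivative ∞
  metric : IsMetric g D
  complex : IsComplex D
  skew : ∀ (x : M) (u v w : TangentSpace 𝓘(ℝ, E) x),
    g.inner x (D.torsion x u v) w = -g.inner x (D.torsion x u w) v

/-- The torsion `3`-form `T^B(u, v, w) = g(T(u, v), w)` of the Bismut connection. -/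
def torsionForm {g : Metric E M} {D : Connection E M} (hD : IsBismut g D) : Form E M 3 := fun x =>
  { toFun := fun v => g.inner x (D.torsion x (v 0) (v 1)) (v 2)
    map_update_add' := by
      intro inst v i y z
      obtain rfl : inst = instDecidableEqFin _ := Subsingleton.elim _ _
      fin_cases i <;> simp
    map_update_smul' := by
      intro inst v i c z
      obtain rfl : inst = instDecidableEqFin _ := Subsingleton.elim _ _
      fin_cases i <;> simp
    cont := continuous_inner g x
      (continuous_torsion D x (continuous_apply 0) (continuous_apply 1)) (continuous_apply 2)
    map_eq_zero_of_eq' := by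
      intro v i j hv hij
      have h12 : ∀ u w, g.inner x (D.torsion x u w) w = 0 := fun u w => by
        have := hD.skew x u w w
        linarith
      have h02 : ∀ u w, g.inner x (D.torsion x u w) u = 0 := fun u w => by
        rw [D.torsion_antisymm, map_neg, neg_apply, h12, neg_zero]
      have h : v 0 = v 1 ∨ v 0 = v 2 ∨ v 1 = v 2 := by
        fin_cases i <;> fin_cases j <;> simp_all
      show g.inner x (D.torsion x (v 0) (v 1)) (v 2) = 0
      rcases h with h | h | h
      · rw [h, D.torsion_self, map_zero, zero_apply]
      · rw [h, h02]
      · rw [h, h12] }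

/-- A Hermitian metric with Bismut connection `D` is SKT (pluriclosed) if `d T^B = 0`. -/
def IsSKT {g : Metric E M} {D : Connection E M} (hD : IsBismut g D) : Prop :=
  d (torsionForm hD) = 0

/-- A Hermitian metric on a complex `n`-manifold is Gauduchon if `d d^c ω^(n-1) = 0`. -/
def IsGauduchon {g : Metric E M} (hg : IsHermitian g) : Prop :=
  d (dc (wedgePow (fundamentalForm hg) (Module.finrank ℂ E - 1))) = 0

/-- A Hermitian metric with Levi-Civita connection `D` is Vaisman if `dω = θ ∧ ω` for some smooth
closed `1`-form `θ` which is parallel for the Levi-Civita connection. -/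
def IsVaisman {g : Metric E M} (hg : IsHermitian g) {D : Connection E M}
    (_hD : IsLeviCivita g D) : Prop :=
  ∃ θ : Form E M 1, IsSmoothForm θ ∧ d θ = 0 ∧
    d (fundamentalForm hg) = wedge θ (fundamentalForm hg) ∧ IsParallel D θ

end Metrics

end Hermitian

end

open Bundle
open scoped Manifold ContDiff

noncomputable section

namespace Hermitian

/-! Write `τ` for the torsion operator of the Bismut connection `∇`, `T` for the torsion form, and
`P(a,b,c,d)` for the sum of `T(τ(a,b),c,d)` over cyclic permutations of `a, b, c`.

On commuting coordinate fields the first Bianchi identity says that the cyclic sum of `∇_a(τ(b,c))`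
vanishes (`FirstBianchi.sum_cov_torsion`), that is, the cyclic sum of `(∇_a T)(b,c,d)` is
`-P(a,b,c,d)`. Since `T(τ(a,b),c,d) = g(τ(a,b),τ(c,d))`, `P` is a 4-form. Comparing the identity
with itself after exchanging `c` and `d` makes `∇T` totally skew as well, so `3∇T = -P`. On the
other hand `dT = 4∇T + 2P = -2∇T`. Hence `dT = 0` forces `∇T = 0` and `P = 0`
(`eq_zero_of_bianchi_of_closed`). As `∇^{LC}_v = ∇_v - τ(v,·)/2`, the derivatives `∇^{LC}T` and `∇T`
differ by `P/2`, which gives the first claim.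

On a surface the Gauduchon condition is `dd^cω = 0`, and `d^cω = T` (`IsBismut.dc_fundamentalForm`),
so again `∇T = 0`. The Lee form is `θ(v) = tr(u ↦ Jτ(Jv,u))/2`. In real dimension four, comparison
on a unitary basis gives `dω = θ ∧ ω` (`sum_torsion_eq_wedge`). A trace built from parallel tensors
is parallel, so `∇θ = 0`. Integrability of `J` gives `θ ∘ τ = 0` (`halfTrace_torsion_eq_zero`), so
`∇^{LC}θ = ∇θ = 0`, and a parallel form for a torsion-free connection is closed. -/

open Filter Topology

/-! ### Linear algebra of Hermitian spaces of real dimension four. -/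

section HermitianAlgebra

variable {V : Type*} [AddCommGroup V] [Module ℝ V] {g : V →ₗ[ℝ] V →ₗ[ℝ] ℝ} {J : V →ₗ[ℝ] V}

/-- A Hermitian inner product on a real vector space of dimension four with a complex structure
has an orthonormal basis of the form `e, J e, f, J f`. -/
lemma exists_unitary_basis (h4 : Module.finrank ℝ V = 4) (hs : ∀ v w, g v w = g w v)
    (hpos : ∀ v, v ≠ 0 → 0 < g v v) (hJ : ∀ v, J (J v) = -v)
    (hg : ∀ v w, g (J v) (J w) = g v w) :
    ∃ b : Module.Basis (Fin 4) ℝ V, (∀ i j, g (b i) (b j) = if i = j then 1 else 0) ∧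
      b 1 = J (b 0) ∧ b 3 = J (b 2) := by
  have hfin : FiniteDimensional ℝ V := FiniteDimensional.of_finrank_pos (by omega)
  have hgJ : ∀ v w, g (J v) w = -g v (J w) := fun v w => by
    rw [← hg v (J w), hJ, map_neg, neg_neg]
  have hgJ0 : ∀ v, g v (J v) = 0 := fun v => by
    have h1 := hgJ v v
    rw [hs] at h1
    linarith
  have hnorm : ∀ v : V, v ≠ 0 → ∃ r : ℝ, g (r • v) (r • v) = 1 := by
    intro v hv
    refine ⟨(Real.sqrt (g v v))⁻¹, ?_⟩
    have h1 := hpos v hv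
    have h2 := Real.sq_sqrt h1.le
    have h3 := (Real.sqrt_pos.2 h1).ne'
    simp only [map_smul, LinearMap.smul_apply, smul_eq_mul]
    field_simp
    linarith
  obtain ⟨e₀, he₀⟩ : ∃ e : V, e ≠ 0 := by
    have : Nontrivial V := Module.nontrivial_of_finrank_pos (R := ℝ) (by omega)
    exact exists_ne 0
  obtain ⟨r, hr⟩ := hnorm e₀ he₀
  set e := r • e₀ with he
  obtain ⟨f₀, hf₀⟩ : ∃ f : V, f ∉ Submodule.span ℝ (Set.range ![e, J e]) := by
    by_contra hcon
    push Not at hcon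
    have htop : Submodule.span ℝ (Set.range ![e, J e]) = ⊤ := (Submodule.eq_top_iff').2 hcon
    have h1 := finrank_range_le_card (R := ℝ) ![e, J e]
    rw [Set.finrank, htop, finrank_top, h4] at h1
    simp at h1
  set f₁ := f₀ - g f₀ e • e - g f₀ (J e) • J e with hf₁
  have hf₁0 : f₁ ≠ 0 := by
    intro h0
    apply hf₀
    have hf : f₀ = g f₀ e • e + g f₀ (J e) • J e := by
      rw [hf₁, sub_sub, sub_eq_zero] at h0
      exact h0
    rw [hf]
    refine add_mem (Submodule.smul_mem _ _ (Submodule.subset_span ⟨0, rfl⟩))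
      (Submodule.smul_mem _ _ (Submodule.subset_span ⟨1, rfl⟩))
  obtain ⟨s, hsf⟩ := hnorm f₁ hf₁0
  set f := s • f₁ with hf
  have hJee : g (J e) (J e) = 1 := (hg e e).trans hr
  have hfe : g f e = 0 := by
    rw [hf, hf₁]
    simp only [map_smul, map_sub, LinearMap.smul_apply, LinearMap.sub_apply, smul_eq_mul, hr,
      hs (J e) e, hgJ0]
    ring
  have hfJe : g f (J e) = 0 := by
    rw [hf, hf₁]
    simp only [map_smul, map_sub, LinearMap.smul_apply, LinearMap.sub_apply, smul_eq_mul, hJee,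
      hgJ0]
    ring
  have hJfe : g (J f) e = 0 := by rw [hgJ, hfJe, neg_zero]
  have hJfJe : g (J f) (J e) = 0 := by rw [hg, hfe]
  have hJff : g (J f) (J f) = 1 := (hg f f).trans hsf
  let v : Fin 4 → V := ![e, J e, f, J f]
  have hv : ∀ i j, g (v i) (v j) = if i = j then 1 else 0 := by
    intro i j
    fin_cases i <;> fin_cases j <;>
      simp [v, hr, hsf, hfe, hfJe, hJfe, hJfJe, hJee, hJff, hgJ0, hs e f, hs e (J f), hs (J e) f,
        hs (J e) (J f), hs (J e) e, hs (J f) f]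
  have hli : LinearIndependent ℝ v := by
    rw [Fintype.linearIndependent_iff]
    intro c hc i
    have h1 := congrArg (fun u => g u (v i)) hc
    simpa [map_sum, LinearMap.sum_apply, hv] using h1
  refine ⟨basisOfLinearIndependentOfCardEqFinrank hli (by simp [h4]), ?_, ?_, ?_⟩
  · intro i j
    simpa using hv i j
  · simp [v]
  · simp [v]

lemma repr_eq_of_orthonormal {b : Module.Basis (Fin 4) ℝ V}
    (hb : ∀ i j, g (b i) (b j) = if i = j then 1 else 0) (u : V) (i : Fin 4) :
    b.repr u i = g u (b i) := by
  conv_rhs => rw [← b.sum_repr u]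
  simp [-Module.Basis.sum_repr, hb]

lemma trace_eq_sum_of_orthonormal {b : Module.Basis (Fin 4) ℝ V}
    (hb : ∀ i j, g (b i) (b j) = if i = j then 1 else 0) (L : V →ₗ[ℝ] V) :
    LinearMap.trace ℝ V L = ∑ i, g (L (b i)) (b i) := by
  rw [LinearMap.trace_eq_matrix_trace ℝ b, Matrix.trace]
  refine Finset.sum_congr rfl fun i _ => ?_
  rw [Matrix.diag_apply, LinearMap.toMatrix_apply, repr_eq_of_orthonormal hb]

/-- A skew trilinear function on a four-dimensional space is determined by four values. -/
lemma skew_trilinear_eq_zero (b : Module.Basis (Fin 4) ℝ V) {F : V → V → V → ℝ}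
    (hlin : ∀ v w, IsLinearMap ℝ fun u => F u v w)
    (h12 : ∀ u v w, F u v w = -F v u w) (h23 : ∀ u v w, F u v w = -F u w v)
    (h012 : F (b 0) (b 1) (b 2) = 0) (h013 : F (b 0) (b 1) (b 3) = 0)
    (h023 : F (b 0) (b 2) (b 3) = 0) (h123 : F (b 1) (b 2) (b 3) = 0) (u v w : V) :
    F u v w = 0 := by
  have hrot : ∀ u v w, F u v w = F v w u := fun u v w => by rw [h12, h23, neg_neg]
  have hred : ∀ v w, (∀ i, F (b i) v w = 0) → ∀ u, F u v w = 0 := by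
    intro v w h u
    have h1 : (hlin v w).mk' _ = 0 := b.ext fun i => by simpa using h i
    exact congrArg (fun l : V →ₗ[ℝ] ℝ => l u) h1
  have hself : ∀ u w, F u u w = 0 := fun u w => by linarith [h12 u u w]
  have hself' : ∀ u w, F u w u = 0 := fun u w => by rw [hrot, hrot]; exact hself u w
  have hself'' : ∀ u w, F w u u = 0 := fun u w => by rw [hrot]; exact hself u w
  have hperm : ∀ u v w, F u v w = 0 →
      F v w u = 0 ∧ F w u v = 0 ∧ F v u w = 0 ∧ F u w v = 0 ∧ F w v u = 0 := by
    intro u v w h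
    have e1 := hrot u v w
    have e2 := hrot v w u
    have e3 := h12 u v w
    have e4 := h23 u v w
    have e5 := h12 v w u
    refine ⟨?_, ?_, ?_, ?_, ?_⟩ <;> linarith
  have hbasis : ∀ i j k, F (b i) (b j) (b k) = 0 := by
    obtain ⟨p1, p2, p3, p4, p5⟩ := hperm _ _ _ h012
    obtain ⟨q1, q2, q3, q4, q5⟩ := hperm _ _ _ h013
    obtain ⟨r1, r2, r3, r4, r5⟩ := hperm _ _ _ h023
    obtain ⟨s1, s2, s3, s4, s5⟩ := hperm _ _ _ h123
    intro i j k
    fin_cases i <;> fin_cases j <;> fin_cases k <;>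
      first
        | exact hself _ _
        | exact hself' _ _
        | exact hself'' _ _
        | assumption
  -- Linearity is known in the first slot only; cyclic rotations bring the other two arguments
  -- there.
  refine hred v w (fun i => ?_) u
  rw [hrot]
  refine hred w _ (fun j => ?_) v
  rw [hrot]
  exact hred _ _ (fun k => by rw [hrot, hrot]; exact hbasis _ _ _ ) w

variable {τ : V →ₗ[ℝ] V →ₗ[ℝ] V}

/-- Half the trace of `u ↦ J (τ (J v) u)`. -/
def halfTrace (τ : V →ₗ[ℝ] V →ₗ[ℝ] V) (J : V →ₗ[ℝ] V) : V →ₗ[ℝ] ℝ where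
  toFun v := (2⁻¹ : ℝ) * LinearMap.trace ℝ V (J ∘ₗ τ (J v))
  map_add' u v := by simp [LinearMap.comp_add, mul_add]
  map_smul' r v := by
    simp [LinearMap.comp_smul]
    ring

/-- In real dimension four, the `3`-form `∑ T(a, b, J c)` is `θ ∧ ω` with `θ` the half trace of the
skew torsion. -/
lemma sum_torsion_eq_wedge (h4 : Module.finrank ℝ V = 4) (hs : ∀ v w, g v w = g w v)
    (hpos : ∀ v, v ≠ 0 → 0 < g v v) (hJ : ∀ v, J (J v) = -v)
    (hg : ∀ v w, g (J v) (J w) = g v w)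
    (h12 : ∀ u v w, g (τ u v) w = -g (τ v u) w) (h23 : ∀ u v w, g (τ u v) w = -g (τ u w) v)
    (a b c : V) :
    g (τ a b) (J c) + g (τ b c) (J a) + g (τ c a) (J b) =
      halfTrace τ J a * g b (J c) + halfTrace τ J b * g c (J a) +
        halfTrace τ J c * g a (J b) := by
  obtain ⟨e, he, he1, he3⟩ := exists_unitary_basis h4 hs hpos hJ hg
  have hgJ : ∀ v w, g v (J w) = -g w (J v) := fun v w => by
    rw [hs w, ← hg (J v) w, hJ, map_neg, LinearMap.neg_apply, neg_neg]
  have hJ0 : J (e 0) = e 1 := he1.symm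
  have hJ2 : J (e 2) = e 3 := he3.symm
  have hJ1 : J (e 1) = -e 0 := by rw [he1, hJ]
  have hJ3 : J (e 3) = -e 2 := by rw [he3, hJ]
  have hrot : ∀ u v w, g (τ u v) w = g (τ v w) u := fun u v w => by rw [h12, h23, neg_neg]
  -- The diagonal entries at `e` and `J e` coincide, as do those at `f` and `J f`; this absorbs the
  -- factor one half.
  have hθ : ∀ v, halfTrace τ J v = -(g (τ (J v) (e 0)) (e 1) + g (τ (J v) (e 2)) (e 3)) := by
    intro v
    have h1 : ∀ w u, g (J u) w = -g u (J w) := fun w u => by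
      rw [← hg u (J w), hJ, map_neg, neg_neg]
    simp only [halfTrace, LinearMap.coe_mk, AddHom.coe_mk]
    rw [trace_eq_sum_of_orthonormal he, Fin.sum_univ_four]
    simp only [LinearMap.comp_apply, h1, hJ0, hJ1, hJ2, hJ3, map_neg]
    rw [h23 (J v) (e 1) (e 0), h23 (J v) (e 3) (e 2)]
    ring
  rw [← sub_eq_zero]
  have hself : ∀ u w, g (τ u u) w = 0 := fun u w => by linarith [h12 u u w]
  have hself' : ∀ u w, g (τ w u) u = 0 := fun u w => by linarith [h23 w u u]
  have hself'' : ∀ u w, g (τ u w) u = 0 := fun u w => by rw [hrot]; exact hself' u w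
  -- For each basis vector one of the two terms of `hθ` has a repeated argument, so `θ` on the basis
  -- is, up to sign, a single component of the torsion.
  have t0 : halfTrace τ J (e 0) = -g (τ (e 1) (e 2)) (e 3) := by rw [hθ, hJ0, hself'']; ring
  have t1 : halfTrace τ J (e 1) = g (τ (e 0) (e 2)) (e 3) := by
    rw [hθ, hJ1]; simp only [map_neg, LinearMap.neg_apply, hself]; ring
  have t2 : halfTrace τ J (e 2) = -g (τ (e 0) (e 1)) (e 3) := by
    rw [hθ, hJ2, hself'', hrot]; ring
  have t3 : halfTrace τ J (e 3) = g (τ (e 0) (e 1)) (e 2) := by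
    rw [hθ, hJ3]; simp only [map_neg, LinearMap.neg_apply, hself]; rw [hrot]; ring
  refine skew_trilinear_eq_zero e (F := fun a b c =>
    g (τ a b) (J c) + g (τ b c) (J a) + g (τ c a) (J b) -
      (halfTrace τ J a * g b (J c) + halfTrace τ J b * g c (J a) +
        halfTrace τ J c * g a (J b))) ?_ ?_ ?_ ?_ ?_ ?_ ?_ a b c
  · intro v w
    constructor
    · intro x y
      simp only [map_add, LinearMap.add_apply]
      ring
    · intro r x
      simp only [map_smul, LinearMap.smul_apply, smul_eq_mul]
      ring
  · intro u v w
    rw [h12 u v, h12 v w, h12 w u, hgJ v w, hgJ w u, hgJ u v]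
    ring
  · intro u v w
    rw [h12 u v, h12 v w, h12 w u, hgJ v w, hgJ w u, hgJ u v]
    ring
  all_goals
    simp only [t0, t1, t2, t3, hJ0, hJ1, hJ2, hJ3, map_neg, he, hself', hself'']
  · simp
  · simp
  · have := hrot (e 1) (e 2) (e 3)
    simp
    linarith
  · have := hrot (e 0) (e 2) (e 3)
    simp
    linarith

/-- In real dimension four, the Lee form annihilates the torsion. -/
lemma halfTrace_torsion_eq_zero (h4 : Module.finrank ℝ V = 4) (hs : ∀ v w, g v w = g w v)
    (hpos : ∀ v, v ≠ 0 → 0 < g v v) (hJ : ∀ v, J (J v) = -v)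
    (hg : ∀ v w, g (J v) (J w) = g v w)
    (h12 : ∀ u v w, g (τ u v) w = -g (τ v u) w) (h23 : ∀ u v w, g (τ u v) w = -g (τ u w) v)
    (hN : ∀ a b c, g (τ a b) c =
      g (τ (J a) (J b)) c + g (τ (J b) (J c)) a + g (τ (J c) (J a)) b) (a b : V) :
    halfTrace τ J (τ a b) = 0 := by
  obtain ⟨e, he, -, -⟩ := exists_unitary_basis h4 hs hpos hJ hg
  set θ := halfTrace τ J
  -- The metric dual of `θ`; the claim becomes that `g (τ a b) ξ` vanishes.
  let ξ : V := ∑ i, θ (e i) • e i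
  have hξ : ∀ w, g ξ w = θ w := by
    intro w
    have : g ξ = θ := e.ext fun i => by simp [ξ, he, map_sum, LinearMap.sum_apply]
    rw [this]
  have hgJ : ∀ v w, g v (J w) = -g w (J v) := fun v w => by
    rw [hs w, ← hg (J v) w, hJ, map_neg, LinearMap.neg_apply, neg_neg]
  have hξJ : θ (J ξ) = 0 := by
    rw [← hξ]
    have := hgJ ξ ξ
    linarith
  -- At `(J a, J b, J ξ)` the left side is `-g (τ a b) ξ` by `hN`. On the right the third term is
  -- zero because `θ (J ξ) = 0`, and the first two are opposite multiples of `θ (J a) * θ (J b)`.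
  have h1 := sum_torsion_eq_wedge h4 hs hpos hJ hg h12 h23 (J a) (J b) (J ξ)
  simp only [hJ, map_neg] at h1
  have h2 := hN a b ξ
  have h3 : g (τ a b) ξ = θ (τ a b) := by rw [hs, hξ]
  have h4 : g (J b) ξ = θ (J b) := by rw [hs, hξ]
  have h5 : g (J ξ) a = -θ (J a) := by rw [hs, hgJ, hξ]
  change _ = θ (J a) * _ + θ (J b) * _ + θ (J ξ) * _ at h1
  rw [hξJ, h4, h5] at h1
  linarith

end HermitianAlgebra

variable {E : Type*} [NormedAddCommGroup E] [NormedSpace ℂ E]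
  {M : Type*} [TopologicalSpace M] [ChartedSpace E M]

set_option linter.unusedSectionVars false

/-! ### Coordinate vector fields and components in a chart. -/

section Frame

variable [IsManifold 𝓘(ℂ, E) ω M]

/-- The coordinate vector field with constant components `a` in the preferred chart at `x₀`. -/
def frame (x₀ : M) (a : E) : VField E M := fun y =>
  (trivializationAt E (TangentSpace 𝓘(ℝ, E)) x₀).symmL ℝ y a

/-- The components of a vector field in the preferred chart at `x₀`. -/
def coord (x₀ : M) (Y : VField E M) (y : M) : E :=
  (trivializationAt E (TangentSpace 𝓘(ℝ, E)) x₀).continuousLinearMapAt ℝ y (Y y)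

lemma frame_add (x₀ : M) (a b : E) (y : M) :
    frame x₀ (a + b) y = frame x₀ a y + frame x₀ b y :=
  map_add _ a b

lemma frame_smul (x₀ : M) (r : ℝ) (a : E) (y : M) :
    frame x₀ (r • a) y = r • frame x₀ a y :=
  map_smul _ r a

lemma mem_baseSet {x₀ y : M} (hy : y ∈ (chartAt E x₀).source) :
    y ∈ (trivializationAt E (TangentSpace 𝓘(ℝ, E)) x₀).baseSet := hy

lemma frame_coord {x₀ y : M} (hy : y ∈ (chartAt E x₀).source) (Y : VField E M) :
    frame x₀ (coord x₀ Y y) y = Y y :=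
  (trivializationAt E (TangentSpace 𝓘(ℝ, E)) x₀).symmL_continuousLinearMapAt (mem_baseSet hy) _

lemma coord_frame {x₀ y : M} (hy : y ∈ (chartAt E x₀).source) (a : E) :
    coord x₀ (frame x₀ a) y = a :=
  (trivializationAt E (TangentSpace 𝓘(ℝ, E)) x₀).continuousLinearMapAt_symmL (mem_baseSet hy) _

lemma coord_eq {x₀ y : M} (hy : y ∈ (chartAt E x₀).source) (Y : VField E M) :
    coord x₀ Y y = (trivializationAt E (TangentSpace 𝓘(ℝ, E)) x₀ ⟨y, Y y⟩).2 := by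
  unfold coord
  rw [Trivialization.continuousLinearMapAt_apply, Trivialization.linearMapAt_apply,
    if_pos (mem_baseSet hy)]

lemma frame_eq_mfderiv {x₀ y : M} (hy : y ∈ (chartAt E x₀).source) (a : E) :
    frame x₀ a y =
      mfderiv 𝓘(ℝ, E) 𝓘(ℝ, E) (extChartAt 𝓘(ℝ, E) x₀).symm (extChartAt 𝓘(ℝ, E) x₀ y) a := by
  unfold frame
  rw [TangentBundle.symmL_trivializationAt hy]
  simp only [modelWithCornersSelf_coe, Set.range_id, mfderivWithin_univ]
  rfl

lemma coord_eq_mfderiv {x₀ y : M} (hy : y ∈ (chartAt E x₀).source) (Y : VField E M) :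
    coord x₀ Y y = mfderiv 𝓘(ℝ, E) 𝓘(ℝ, E) (extChartAt 𝓘(ℝ, E) x₀) y (Y y) := by
  unfold coord
  rw [TangentBundle.continuousLinearMapAt_trivializationAt hy]
  rfl

lemma coord_self (x : M) (Y : VField E M) : coord x Y x = Y x := by
  rw [coord_eq_mfderiv (mem_chart_source E x), mfderiv_extChartAt_self]
  rfl

lemma frame_self (x : M) (a : E) : frame x a x = a := by
  rw [← coord_self x (frame x a), coord_frame (mem_chart_source E x)]

lemma source_mem_nhds {x₀ y : M} (hy : y ∈ (chartAt E x₀).source) :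
    (chartAt E x₀).source ∈ 𝓝 y :=
  (chartAt E x₀).open_source.mem_nhds hy

lemma smoothAt_iff_coord {x₀ y : M} (hy : y ∈ (chartAt E x₀).source) (Y : VField E M) :
    SmoothAt Y y ↔ ContMDiffAt 𝓘(ℝ, E) 𝓘(ℝ, E) ∞ (coord x₀ Y) y := by
  unfold SmoothAt
  have h := Trivialization.contMDiffAt_section_iff (IB := 𝓘(ℝ, E)) (n := ∞) (s := Y)
    (trivializationAt E (TangentSpace 𝓘(ℝ, E)) x₀) (mem_baseSet hy)
  refine h.trans (EventuallyEq.contMDiffAt_iff ?_)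
  filter_upwards [source_mem_nhds hy] with z hz using (coord_eq hz Y).symm

lemma diffAt_iff_coord {x₀ y : M} (hy : y ∈ (chartAt E x₀).source) (Y : VField E M) :
    DiffAt Y y ↔ MDifferentiableAt 𝓘(ℝ, E) 𝓘(ℝ, E) (coord x₀ Y) y := by
  unfold DiffAt
  have h := Trivialization.mdifferentiableAt_section_iff 𝓘(ℝ, E)
    (trivializationAt E (TangentSpace 𝓘(ℝ, E)) x₀) Y (mem_baseSet hy)
  refine h.trans (EventuallyEq.mdifferentiableAt_iff ?_)
  filter_upwards [source_mem_nhds hy] with z hz using (coord_eq hz Y).symm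

lemma SmoothAt.diffAt {Y : VField E M} {y : M} (h : SmoothAt Y y) : DiffAt Y y :=
  ContMDiffAt.mdifferentiableAt h (by simp)

lemma smoothAt_frame {x₀ y : M} (hy : y ∈ (chartAt E x₀).source) (a : E) :
    SmoothAt (frame x₀ a) y := by
  rw [smoothAt_iff_coord hy]
  refine (contMDiffAt_const (c := a)).congr_of_eventuallyEq ?_
  filter_upwards [source_mem_nhds hy] with z hz using coord_frame hz a

lemma SmoothAt.congr {X Y : VField E M} {y : M} (h : SmoothAt X y) (hXY : Y =ᶠ[𝓝 y] X) :
    SmoothAt Y y := by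
  refine ContMDiffAt.congr_of_eventuallyEq h ?_
  filter_upwards [hXY] with z hz
  rw [hz]

lemma frame_eventuallyEq_mpullback {x₀ y : M} (hy : y ∈ (chartAt E x₀).source) (a : E) :
    frame x₀ a =ᶠ[𝓝 y]
      VectorField.mpullback 𝓘(ℝ, E) 𝓘(ℝ, E) (extChartAt 𝓘(ℝ, E) x₀)
        (fun z => (a : TangentSpace 𝓘(ℝ, E) z)) := by
  filter_upwards [source_mem_nhds hy] with z hz
  have hinv := isInvertible_mfderiv_extChartAt (I := 𝓘(ℝ, E)) (x := x₀) (y := z) (by simpa using hz)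
  have h1 := coord_eq_mfderiv hz (frame x₀ a)
  rw [coord_frame hz] at h1
  unfold VectorField.mpullback
  obtain ⟨e, he⟩ := hinv
  rw [← he] at h1 ⊢
  rw [ContinuousLinearMap.inverse_equiv]
  exact ((e.symm_apply_eq).2 h1).symm

/-- Coordinate fields are pull-backs of constant fields under the chart, and the Lie bracket is
natural under pull-back. -/
lemma mlieBracket_frame [CompleteSpace E] {x₀ y : M} (hy : y ∈ (chartAt E x₀).source) (a b : E) :
    VectorField.mlieBracket 𝓘(ℝ, E) (frame x₀ a) (frame x₀ b) y = 0 := by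
  let c : E → (Π z : E, TangentSpace 𝓘(ℝ, E) z) := fun a _ => a
  have hc : ∀ a : E, MDifferentiableAt 𝓘(ℝ, E) (𝓘(ℝ, E).prod 𝓘(ℝ, E))
      (fun z : E => (⟨z, c a z⟩ : TangentBundle 𝓘(ℝ, E) E)) (extChartAt 𝓘(ℝ, E) x₀ y) := by
    intro a
    have : ContMDiffAt 𝓘(ℝ, E) (𝓘(ℝ, E).prod 𝓘(ℝ, E)) 1
      (fun z : E => (⟨z, c a z⟩ : TangentBundle 𝓘(ℝ, E) E)) (extChartAt 𝓘(ℝ, E) x₀ y) :=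
      contMDiffAt_vectorSpace_iff_contDiffAt.2 contDiffAt_const
    exact this.mdifferentiableAt (by simp)
  have h0 : VectorField.mlieBracket 𝓘(ℝ, E) (c a) (c b) (extChartAt 𝓘(ℝ, E) x₀ y) = 0 := by
    rw [← VectorField.mlieBracketWithin_univ, VectorField.mlieBracketWithin_eq_lieBracketWithin,
      VectorField.lieBracketWithin_univ]
    simp [VectorField.lieBracket]
    rfl
  have h := VectorField.mpullback_mlieBracket (n := ω) (hc a) (hc b)
    (contMDiffAt_extChartAt' hy) (by simp)
  rw [(frame_eventuallyEq_mpullback hy a).mlieBracket_vectorField_eq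
    (frame_eventuallyEq_mpullback hy b)]
  refine h.symm.trans ?_
  rw [VectorField.mpullback_apply, h0]
  exact map_zero _

end Frame

/-! ### Smoothness of maps into finite-dimensional spaces, tested by functionals. -/

section FiniteDimensionalTarget

lemma contDiffAt_of_forall_dual {V F : Type*} [NormedAddCommGroup V] [NormedSpace ℝ V]
    [NormedAddCommGroup F] [NormedSpace ℝ F] [FiniteDimensional ℝ F] {f : V → F} {x : V}
    {n : WithTop ℕ∞} (h : ∀ l : F →L[ℝ] ℝ, ContDiffAt ℝ n (fun y => l (f y)) x) :
    ContDiffAt ℝ n f x := by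
  let e : F ≃L[ℝ] (Fin (Module.finrank ℝ F) → ℝ) :=
    (Module.finBasis ℝ F).equivFun.toContinuousLinearEquiv
  have h2 : ContDiffAt ℝ n (fun y => e (f y)) x := by
    rw [contDiffAt_pi]
    intro i
    exact h ((ContinuousLinearMap.proj i).comp (e : F →L[ℝ] (Fin (Module.finrank ℝ F) → ℝ)))
  have h3 := e.symm.contDiff.contDiffAt.comp x h2
  simpa [Function.comp_def] using h3

/-- In finite dimension a separating family of functionals spans the dual. For alternating forms the
evaluations at tuples of vectors are such a family. -/
lemma contDiffAt_of_separating {V F ι : Type*} [NormedAddCommGroup V] [NormedSpace ℝ V]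
    [NormedAddCommGroup F] [NormedSpace ℝ F] [FiniteDimensional ℝ F] {f : V → F} {x : V}
    {n : WithTop ℕ∞} (L : ι → F →L[ℝ] ℝ) (hL : ∀ v, (∀ i, L i v = 0) → v = 0)
    (h : ∀ i, ContDiffAt ℝ n (fun y => L i (f y)) x) :
    ContDiffAt ℝ n f x := by
  refine contDiffAt_of_forall_dual fun l => ?_
  have hmem : (l : F →ₗ[ℝ] ℝ) ∈ Submodule.span ℝ (Set.range fun i => (L i : F →ₗ[ℝ] ℝ)) := by
    refine FiniteDimensional.mem_span_of_iInf_ker_le_ker fun v hv => ?_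
    rw [hL v (by simpa using hv)]
    exact zero_mem _
  have key : ∀ m ∈ Submodule.span ℝ (Set.range fun i => (L i : F →ₗ[ℝ] ℝ)),
      ContDiffAt ℝ n (fun y => m (f y)) x := by
    intro m hm
    induction hm using Submodule.span_induction with
    | mem m hm => obtain ⟨i, rfl⟩ := hm; exact h i
    | zero => exact contDiffAt_const
    | add a b _ _ ha hb => exact ha.add hb
    | smul r a _ ha => exact contDiffAt_const.smul ha
  exact key _ hmem

lemma finiteDimensional_continuousAlternatingMap {V : Type*} [NormedAddCommGroup V]
    [NormedSpace ℝ V] [FiniteDimensional ℝ V] (k : ℕ) :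
    FiniteDimensional ℝ (V [⋀^Fin k]→L[ℝ] ℝ) := by
  let Φ : (V [⋀^Fin k]→L[ℝ] ℝ) →ₗ[ℝ] MultilinearMap ℝ (fun _ : Fin k => V) ℝ :=
    { toFun := fun a => a.toAlternatingMap.toMultilinearMap
      map_add' := fun _ _ => rfl
      map_smul' := fun _ _ => rfl }
  refine FiniteDimensional.of_injective Φ fun a b hab => ?_
  ext v
  exact congrArg (fun m : MultilinearMap ℝ (fun _ : Fin k => V) ℝ => m v) hab

lemma contDiffAt_continuousAlternatingMap {W V : Type*} [NormedAddCommGroup W] [NormedSpace ℝ W]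
    [NormedAddCommGroup V]
    [NormedSpace ℝ V] [FiniteDimensional ℝ V] {k : ℕ} {f : W → V [⋀^Fin k]→L[ℝ] ℝ} {x : W}
    {n : WithTop ℕ∞} (h : ∀ v, ContDiffAt ℝ n (fun y => f y v) x) : ContDiffAt ℝ n f x := by
  have := finiteDimensional_continuousAlternatingMap (V := V) k
  refine contDiffAt_of_separating (fun v => ContinuousAlternatingMap.apply ℝ V ℝ v) ?_ h
  intro a ha
  ext v
  exact ha v

end FiniteDimensionalTarget

/-! ### Complex structure and exterior derivative in coordinates. -/

section Charts

variable [IsManifold 𝓘(ℂ, E) ω M]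

/-- The frame at `y` is the derivative of the transition map to the chart preferred at `y`. That map
is holomorphic, so its derivative commutes with multiplication by `i`. -/
lemma J_frame {x₀ y : M} (hy : y ∈ (chartAt E x₀).source) (a : E) :
    J y (frame x₀ a y) = frame x₀ (Complex.I • a) y := by
  let f : E → E := chartAt E y ∘ (chartAt E x₀).symm
  have hd : DifferentiableAt ℂ f (chartAt E x₀ y) := by
    have key := (contDiffGroupoid ω 𝓘(ℂ, E)).compatible (chart_mem_atlas E x₀)
      (chart_mem_atlas E y)
    rw [contDiffGroupoid, mem_groupoid_of_pregroupoid] at key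
    have h1 : ContDiffOn ℂ ω f ((chartAt E x₀).symm.trans (chartAt E y)).source := by
      simpa [contDiffPregroupoid, f] using key.1
    have hmem : chartAt E x₀ y ∈ ((chartAt E x₀).symm.trans (chartAt E y)).source := by
      simp [hy]
    exact (h1.contDiffAt (((chartAt E x₀).symm.trans (chartAt E y)).open_source.mem_nhds
      hmem)).differentiableAt (by simp)
  have hfr : ∀ a : E, frame x₀ a y = fderiv ℂ f (chartAt E x₀ y) a := by
    intro a
    unfold frame
    rw [TangentBundle.symmL_trivializationAt_eq_core hy]
    rw [tangentBundleCore_coordChange_achart]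
    have h2 := (hd.hasFDerivAt.restrictScalars ℝ).fderiv
    have h3 : fderivWithin ℝ (extChartAt 𝓘(ℝ, E) y ∘ (extChartAt 𝓘(ℝ, E) x₀).symm)
        (Set.range 𝓘(ℝ, E)) (extChartAt 𝓘(ℝ, E) x₀ y) =
        (fderiv ℂ f (chartAt E x₀ y)).restrictScalars ℝ := by
      rw [← h2]
      simp [fderivWithin_univ, f]
    rw [h3]
    rfl
  rw [hfr, hfr]
  exact ((fderiv ℂ f (chartAt E x₀ y)).map_smul Complex.I a).symm

lemma inChart_apply {k : ℕ} (α : Form E M k) (x₀ : M) {z : E}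
    (hz : z ∈ (extChartAt 𝓘(ℝ, E) x₀).target) (v : Fin k → E) :
    inChart α x₀ z v = α ((extChartAt 𝓘(ℝ, E) x₀).symm z)
      (fun i => frame x₀ (v i) ((extChartAt 𝓘(ℝ, E) x₀).symm z)) := by
  have hs : (extChartAt 𝓘(ℝ, E) x₀).symm z ∈ (chartAt E x₀).source := by
    simpa using (extChartAt 𝓘(ℝ, E) x₀).map_target hz
  have : (fun i => frame x₀ (v i) ((extChartAt 𝓘(ℝ, E) x₀).symm z)) =
      fun i => (mfderiv 𝓘(ℝ, E) 𝓘(ℝ, E) (extChartAt 𝓘(ℝ, E) x₀).symm z (v i)) := by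
    funext i
    rw [frame_eq_mfderiv hs, (extChartAt 𝓘(ℝ, E) x₀).right_inv hz]
  rw [this]
  rfl

lemma contDiffAt_comp_extChartAt_symm {F : Type*} [NormedAddCommGroup F] [NormedSpace ℝ F]
    {f : M → F} {x₀ y : M} (hy : y ∈ (chartAt E x₀).source)
    (hf : ContMDiffAt 𝓘(ℝ, E) 𝓘(ℝ, F) ∞ f y) :
    ContDiffAt ℝ ∞ (fun z => f ((extChartAt 𝓘(ℝ, E) x₀).symm z)) (extChartAt 𝓘(ℝ, E) x₀ y) := by
  have hy' : y ∈ (extChartAt 𝓘(ℝ, E) x₀).source := by simpa using hy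
  rw [← contMDiffAt_iff_contDiffAt]
  have h1 : ContMDiffAt 𝓘(ℝ, E) 𝓘(ℝ, E) ∞ (extChartAt 𝓘(ℝ, E) x₀).symm
      (extChartAt 𝓘(ℝ, E) x₀ y) :=
    (contMDiffOn_extChartAt_symm x₀).contMDiffAt
      (extChartAt_target_mem_nhds' ((extChartAt 𝓘(ℝ, E) x₀).map_source hy'))
  refine ContMDiffAt.comp (I' := 𝓘(ℝ, E)) (g := f) _ ?_ h1
  rwa [(extChartAt 𝓘(ℝ, E) x₀).left_inv hy']

variable [FiniteDimensional ℂ E]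

/-- The components of `α` in the coordinate frame at `x₀` are smooth at `y`. -/
def SmoothComponents {k : ℕ} (α : Form E M k) (x₀ y : M) : Prop :=
  ∀ v : Fin k → E,
    ContMDiffAt 𝓘(ℝ, E) 𝓘(ℝ, ℝ) ∞ (fun z => α z (fun i => frame x₀ (v i) z)) y

lemma SmoothComponents.contDiffAt_inChart {k : ℕ} {α : Form E M k} {x₀ y : M}
    (h : SmoothComponents α x₀ y) (hy : y ∈ (chartAt E x₀).source) :
    ContDiffAt ℝ ∞ (inChart α x₀) (extChartAt 𝓘(ℝ, E) x₀ y) := by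
  have hy' : y ∈ (extChartAt 𝓘(ℝ, E) x₀).source := by simpa using hy
  refine contDiffAt_continuousAlternatingMap fun v => ?_
  refine (contDiffAt_comp_extChartAt_symm hy (h v)).congr_of_eventuallyEq ?_
  filter_upwards [extChartAt_target_mem_nhds' ((extChartAt 𝓘(ℝ, E) x₀).map_source hy')] with z hz
  exact inChart_apply α x₀ hz v

lemma isSmoothForm_of_components {k : ℕ} {α : Form E M k}
    (h : ∀ x₀ : M, ∀ y ∈ (chartAt E x₀).source, SmoothComponents α x₀ y) : IsSmoothForm α := by
  intro x₀ z hz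
  have hs : (extChartAt 𝓘(ℝ, E) x₀).symm z ∈ (chartAt E x₀).source := by
    simpa using (extChartAt 𝓘(ℝ, E) x₀).map_target hz
  have := (h x₀ _ hs).contDiffAt_inChart hs
  rw [(extChartAt 𝓘(ℝ, E) x₀).right_inv hz] at this
  exact this.contDiffWithinAt

lemma mvfderiv_eq_fderiv {F : Type*} [NormedAddCommGroup F] [NormedSpace ℝ F] {f : M → F} {x : M}
    (hf : MDifferentiableAt 𝓘(ℝ, E) 𝓘(ℝ, F) f x) (v : E) :
    mvfderiv 𝓘(ℝ, E) f x v =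
      fderiv ℝ (fun z => f ((extChartAt 𝓘(ℝ, E) x).symm z)) (extChartAt 𝓘(ℝ, E) x x) v := by
  rw [hf.mvfderiv]
  simp only [modelWithCornersSelf_coe, Set.range_id, fderivWithin_univ]
  rfl

/-- The invariant formula for `d` without bracket terms: coordinate fields commute, and the chart at
`x` has identity derivative at its own base point. -/
lemma d_apply {k : ℕ} {α : Form E M k} {x : M} (h : SmoothComponents α x x)
    (v : Fin (k + 1) → E) :
    d α x v = ∑ i, (-1) ^ i.val •
      mvfderiv 𝓘(ℝ, E) (fun z => α z (fun j => frame x (i.removeNth v j) z)) x (v i) := by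
  have hx := mem_chart_source E x
  have hd := (h.contDiffAt_inChart hx).differentiableAt (by simp)
  have h1 : d α x v = extDeriv (inChart α x) (extChartAt 𝓘(ℝ, E) x x) v := by
    unfold d
    rw [mfderiv_extChartAt_self]
    rfl
  rw [h1, extDeriv_apply hd]
  refine Finset.sum_congr rfl fun i _ => ?_
  rw [mvfderiv_eq_fderiv ((h _).mdifferentiableAt (by simp))]
  congr 2
  refine Filter.EventuallyEq.fderiv_eq ?_
  filter_upwards [extChartAt_target_mem_nhds x] with z hz
  exact inChart_apply α x hz _

end Charts

/-! ### Regularity of vector fields and nondegeneracy of the metric. -/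

section Fields

variable [IsManifold 𝓘(ℂ, E) ω M]

lemma SmoothAt.sub {X Y : VField E M} {x : M} (hX : SmoothAt X x) (hY : SmoothAt Y x) :
    SmoothAt (fun y => X y - Y y) x :=
  ContMDiffAt.sub_section hX hY

lemma DiffAt.sub {X Y : VField E M} {x : M} (hX : DiffAt X x) (hY : DiffAt Y x) :
    DiffAt (fun y => X y - Y y) x :=
  mdifferentiableAt_sub_section hX hY

lemma diffAt_smul {f : M → ℝ} {Y : VField E M} {x : M}
    (hf : MDifferentiableAt 𝓘(ℝ, E) 𝓘(ℝ, ℝ) f x) (hY : DiffAt Y x) :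
    DiffAt (fun y => f y • Y y) x :=
  MDifferentiableAt.smul_section hf hY

lemma DiffAt.sum {ι : Type*} {s : Finset ι} {Y : ι → VField E M} {x : M}
    (hY : ∀ i ∈ s, DiffAt (Y i) x) : DiffAt (fun y => ∑ i ∈ s, Y i y) x :=
  MDifferentiableAt.sum_section hY

lemma coord_J {x₀ y : M} (hy : y ∈ (chartAt E x₀).source) (Y : VField E M) :
    coord x₀ (fun z => J z (Y z)) y = Complex.I • coord x₀ Y y := by
  have h : J y (Y y) = frame x₀ (Complex.I • coord x₀ Y y) y := by
    rw [← J_frame hy, frame_coord hy]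
  rw [← coord_frame hy (Complex.I • coord x₀ Y y)]
  exact congrArg _ h

lemma SmoothAt.J {Y : VField E M} {x : M} (hY : SmoothAt Y x) : SmoothAt (fun z => J z (Y z)) x := by
  have hx := mem_chart_source E x
  rw [smoothAt_iff_coord hx] at hY ⊢
  refine ContMDiffAt.congr_of_eventuallyEq (f := fun z => Complex.I • coord x Y z) ?_ ?_
  · exact ((Complex.I • ContinuousLinearMap.id ℝ E : E →L[ℝ] E).contMDiff).contMDiffAt.comp x hY
  · filter_upwards [source_mem_nhds hx] with z hz using coord_J hz Y

lemma DiffAt.J {Y : VField E M} {x : M} (hY : DiffAt Y x) : DiffAt (fun z => J z (Y z)) x := by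
  have hx := mem_chart_source E x
  rw [diffAt_iff_coord hx] at hY ⊢
  refine MDifferentiableAt.congr_of_eventuallyEq (f := fun z => Complex.I • coord x Y z) ?_ ?_
  · exact ((Complex.I • ContinuousLinearMap.id ℝ E : E →L[ℝ] E).contMDiff
      (n := 1)).contMDiffAt.mdifferentiableAt (by simp) |>.comp x hY
  · filter_upwards [source_mem_nhds hx] with z hz using coord_J hz Y

variable [FiniteDimensional ℂ E]

lemma smoothAt_inner (g : Metric E M) {X Y : VField E M} {x : M} (hX : SmoothAt X x)
    (hY : SmoothAt Y x) :
    ContMDiffAt 𝓘(ℝ, E) 𝓘(ℝ, ℝ) ∞ (fun y => g.inner y (X y) (Y y)) x := by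
  have : ContMDiffAt 𝓘(ℝ, E) (𝓘(ℝ, E).prod 𝓘(ℝ, ℝ)) ∞
      (fun m ↦ TotalSpace.mk' ℝ (E := Bundle.Trivial M ℝ) m (g.inner m (X m) (Y m))) x := by
    apply ContMDiffAt.clm_bundle_apply₂ (F₁ := E) (F₂ := E)
    · exact g.contMDiff.contMDiffAt
    · exact hX
    · exact hY
  simp only [contMDiffAt_totalSpace] at this
  exact this.2

lemma Metric.eq_of_inner_eq (g : Metric E M) {x : M} {u v : TangentSpace 𝓘(ℝ, E) x}
    (h : ∀ w, g.inner x u w = g.inner x v w) : u = v := by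
  by_contra hne
  have hpos := g.pos x (u - v) (sub_ne_zero.2 hne)
  have h0 : g.inner x (u - v) = g.inner x u - g.inner x v := map_sub _ u v
  have h1 : g.inner x (u - v) (u - v) = g.inner x u (u - v) - g.inner x v (u - v) :=
    congrArg (fun L => L (u - v)) h0
  rw [h1, h (u - v), sub_self] at hpos
  exact lt_irrefl _ hpos

end Fields

/-! ### Calculus of covariant derivatives. -/

section ConnectionLemmas

variable [IsManifold 𝓘(ℂ, E) ω M] [FiniteDimensional ℂ E]

lemma cov_add (D : Connection E M) {X Y : VField E M} {x : M} (hX : DiffAt X x) (hY : DiffAt Y x) :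
    D (fun y => X y + Y y) x = D X x + D Y x :=
  D.isCovariantDerivativeOnUniv.add hX hY

lemma cov_smul (D : Connection E M) {f : M → ℝ} {Y : VField E M} {x : M}
    (hf : MDifferentiableAt 𝓘(ℝ, E) 𝓘(ℝ, ℝ) f x) (hY : DiffAt Y x)
    (v : TangentSpace 𝓘(ℝ, E) x) :
    D (fun y => f y • Y y) x v = f x • D Y x v + mvfderiv 𝓘(ℝ, E) f x v • Y x := by
  have h := D.isCovariantDerivativeOnUniv.leibniz hY hf
  exact congrArg (fun L => L v) h

lemma cov_congr (D : Connection E M) {X Y : VField E M} {x : M} (hX : DiffAt X x) (hY : DiffAt Y x)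
    (h : X =ᶠ[𝓝 x] Y) : D X x = D Y x :=
  D.isCovariantDerivativeOnUniv.congr_of_eventuallyEq hX hY univ_mem h

lemma cov_zero (D : Connection E M) (x : M) : D (fun _ => 0) x = 0 :=
  congrFun D.zero x

lemma DiffAt.congr {X Y : VField E M} {y : M} (h : DiffAt X y) (hXY : Y =ᶠ[𝓝 y] X) :
    DiffAt Y y := by
  refine MDifferentiableAt.congr_of_eventuallyEq h ?_
  filter_upwards [hXY] with z hz
  rw [hz]

lemma cov_sum (D : Connection E M) {ι : Type*} (s : Finset ι) {Y : ι → VField E M} {x : M}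
    (hY : ∀ i ∈ s, DiffAt (Y i) x) :
    D (fun y => ∑ i ∈ s, Y i y) x = ∑ i ∈ s, D (Y i) x := by
  classical
  induction s using Finset.induction_on with
  | empty => simpa using cov_zero D x
  | insert a s ha ih =>
    simp only [Finset.sum_insert ha]
    rw [cov_add D (hY a (Finset.mem_insert_self a s))
      (DiffAt.sum fun i hi => hY i (Finset.mem_insert_of_mem hi)),
      ih fun i hi => hY i (Finset.mem_insert_of_mem hi)]

/-- Smoothness of `D` is a statement about globally smooth fields, so a field smooth only near `x`
is first cut off by a bump function. -/
lemma smoothAt_cov [T2Space M] {D : Connection E M} (hD : D.ContMDiffCovariantDerivative ∞)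
    {X Y : VField E M} {x : M} (hX : SmoothAt X x) (hY : ∀ᶠ y in 𝓝 x, SmoothAt Y y) :
    SmoothAt (fun y => D Y y (X y)) x := by
  obtain ⟨u, hu, huo, hxu⟩ := eventually_nhds_iff.1 hY
  obtain ⟨f, -, hf⟩ := (SmoothBumpFunction.nhds_basis_tsupport (I := 𝓘(ℝ, E)) x).mem_iff.1
    (huo.mem_nhds hxu)
  let Z : VField E M := fun y => f y • Y y
  have hZ : ContMDiff 𝓘(ℝ, E) (𝓘(ℝ, E).prod 𝓘(ℝ, E)) ∞
      (fun y => (⟨y, Z y⟩ : TangentBundle 𝓘(ℝ, E) M)) :=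
    ContMDiffOn.smul_section_of_tsupport f.contMDiff.contMDiffOn huo hf
      fun y hy => (hu y hy).contMDiffWithinAt
  have hD' := hD.contMDiff.contMDiff (σ := Z) (by simpa using hZ.contMDiffOn)
  have hZ' : SmoothAt (fun y => D Z y (X y)) x :=
    ContMDiffAt.clm_bundle_apply (F₁ := E) (F₂ := E) (hD'.contMDiffAt univ_mem) hX
  refine hZ'.congr ?_
  have hone := f.eventuallyEq_one
  -- The bump function equals one near every `y` close to `x`, not just at `y`, so locality of `D`
  -- applies at `y`.
  filter_upwards [hone.eventuallyEq_nhds, hY] with y hy hYy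
  have hYZ : Y =ᶠ[𝓝 y] Z := by
    filter_upwards [hy] with z hz
    have : f z • Y z = (1 : ℝ) • Y z := congrArg (· • Y z) hz
    exact ((one_smul ℝ (Y z)).symm.trans this.symm)
  have hZy : SmoothAt Z y := hZ y
  rw [cov_congr D hYy.diffAt hZy.diffAt hYZ]

lemma torsion_apply' (D : Connection E M) {X Y : VField E M} {x : M} (hX : DiffAt X x)
    (hY : DiffAt Y x) :
    D.torsion x (X x) (Y x) = D Y x (X x) - D X x (Y x) -
      VectorField.mlieBracket 𝓘(ℝ, E) X Y x :=
  D.torsion_apply hX hY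

lemma torsion_frame (D : Connection E M) {x₀ y : M} (hy : y ∈ (chartAt E x₀).source) (a b : E) :
    D.torsion y (frame x₀ a y) (frame x₀ b y) =
      D (frame x₀ b) y (frame x₀ a y) - D (frame x₀ a) y (frame x₀ b y) := by
  have : CompleteSpace E := FiniteDimensional.complete ℂ E
  rw [torsion_apply' D (smoothAt_frame hy a).diffAt (smoothAt_frame hy b).diffAt,
    mlieBracket_frame hy, sub_zero]

lemma eventually_smoothAt_frame {x₀ y : M} (hy : y ∈ (chartAt E x₀).source) (a : E) :
    ∀ᶠ z in 𝓝 y, SmoothAt (frame x₀ a) z := by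
  filter_upwards [source_mem_nhds hy] with z hz using smoothAt_frame hz a

lemma smoothAt_cov_frame [T2Space M] {D : Connection E M} (hD : D.ContMDiffCovariantDerivative ∞)
    {x₀ y : M} (hy : y ∈ (chartAt E x₀).source) (a b : E) :
    SmoothAt (fun z => D (frame x₀ b) z (frame x₀ a z)) y :=
  smoothAt_cov hD (smoothAt_frame hy a) (eventually_smoothAt_frame hy b)

/-- The torsion of two coordinate vector fields. -/
def torsionFrame (D : Connection E M) (x₀ : M) (a b : E) : VField E M := fun y =>
  D.torsion y (frame x₀ a y) (frame x₀ b y)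

lemma smoothAt_torsionFrame [T2Space M] {D : Connection E M}
    (hD : D.ContMDiffCovariantDerivative ∞)
    {x₀ y : M} (hy : y ∈ (chartAt E x₀).source) (a b : E) :
    SmoothAt (torsionFrame D x₀ a b) y := by
  refine ((smoothAt_cov_frame hD hy a b).sub (smoothAt_cov_frame hD hy b a)).congr ?_
  filter_upwards [source_mem_nhds hy] with z hz using torsion_frame D hz a b

lemma mvfderiv_clm_comp {F G : Type*} [NormedAddCommGroup F] [NormedSpace ℝ F]
    [NormedAddCommGroup G] [NormedSpace ℝ G] (l : F →L[ℝ] G) {f : M → F} {x : M}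
    (hf : MDifferentiableAt 𝓘(ℝ, E) 𝓘(ℝ, F) f x) (v : TangentSpace 𝓘(ℝ, E) x) :
    mvfderiv 𝓘(ℝ, E) (fun y => l (f y)) x v = l (mvfderiv 𝓘(ℝ, E) f x v) := by
  have hl : MDifferentiableAt 𝓘(ℝ, E) 𝓘(ℝ, G) (fun y => l (f y)) x :=
    ((l.contMDiff (n := 1)).contMDiffAt.mdifferentiableAt (by simp)).comp x hf
  refine (mvfderiv_eq_fderiv hl v).trans
    (Eq.trans ?_ (congrArg l (mvfderiv_eq_fderiv hf v)).symm)
  have hfd : DifferentiableAt ℝ (fun z => f ((extChartAt 𝓘(ℝ, E) x).symm z))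
      (extChartAt 𝓘(ℝ, E) x x) := by
    have h : DifferentiableWithinAt ℝ (fun z => f ((extChartAt 𝓘(ℝ, E) x).symm z))
      (Set.range 𝓘(ℝ, E)) (extChartAt 𝓘(ℝ, E) x x) :=
      hf.differentiableWithinAt_writtenInExtChartAt
    rwa [modelWithCornersSelf_coe, Set.range_id, differentiableWithinAt_univ] at h
  exact congrArg (fun L => L v) (l.hasFDerivAt.comp _ hfd.hasFDerivAt).fderiv

/-- The covariant derivative in coordinates: the derivative of the components plus the
Christoffel term. -/
lemma cov_eq_coord (D : Connection E M) {Y : VField E M} {x : M} (hY : DiffAt Y x)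
    (v : TangentSpace 𝓘(ℝ, E) x) :
    D Y x v = frame x (mvfderiv 𝓘(ℝ, E) (coord x Y) x v) x + D (frame (E := E) x (Y x)) x v := by
  have hx := mem_chart_source E x
  let b := Module.finBasis ℝ E
  have hc := (diffAt_iff_coord hx Y).1 hY
  let l : Fin (Module.finrank ℝ E) → E →L[ℝ] ℝ := fun i => (b.coord i).toContinuousLinearMap
  let c : Fin (Module.finrank ℝ E) → M → ℝ := fun i y => l i (coord x Y y)
  have hdl : ∀ i, MDifferentiableAt 𝓘(ℝ, E) 𝓘(ℝ, ℝ) (c i) x := fun i =>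
    ((l i).contMDiff (n := 1)).contMDiffAt.mdifferentiableAt (by simp) |>.comp x hc
  have hfr : ∀ i, DiffAt (frame x (b i)) x := fun i => (smoothAt_frame hx _).diffAt
  have hsum : Y =ᶠ[𝓝 x] fun y => ∑ i, c i y • frame x (b i) y := by
    filter_upwards [source_mem_nhds hx] with y hy
    have h1 : coord x Y y = ∑ i, c i y • b i := (b.sum_repr _).symm
    calc Y y = frame x (coord x Y y) y := (frame_coord hy Y).symm
      _ = frame x (∑ i, c i y • b i) y := by rw [← h1]
      _ = _ := by
        unfold frame
        rw [map_sum]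
        simp only [map_smul]
        rfl
  have hd : ∀ i, DiffAt (fun y => c i y • frame x (b i) y) x := fun i => diffAt_smul (hdl i) (hfr i)
  rw [cov_congr D hY (DiffAt.sum fun i _ => hd i) hsum, cov_sum D _ fun i _ => hd i]
  have h2 : ∀ i, D (fun y => c i y • frame x (b i) y) x v =
      c i x • D (frame x (b i)) x v + mvfderiv 𝓘(ℝ, E) (c i) x v • frame x (b i) x :=
    fun i => cov_smul D (hdl i) (hfr i) v
  have h3 : frame (E := E) x (Y x) = fun y => ∑ i, c i x • frame x (b i) y := by
    have h1 : (Y x : E) = ∑ i, c i x • b i := by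
      rw [← coord_self x Y]
      exact (b.sum_repr _).symm
    funext y
    unfold frame
    conv_lhs => rw [h1]
    rw [map_sum]
    simp only [map_smul]
  have h4 : D (frame (E := E) x (Y x)) x v = ∑ i, c i x • D (frame x (b i)) x v := by
    rw [h3, cov_sum D _ fun i _ => diffAt_smul mdifferentiableAt_const (hfr i),
      sum_apply]
    refine Finset.sum_congr rfl fun i _ => ?_
    rw [cov_smul D mdifferentiableAt_const (hfr i), mvfderiv_const]
    simp
  have h5 : frame x (mvfderiv 𝓘(ℝ, E) (coord x Y) x v) x =
      ∑ i, mvfderiv 𝓘(ℝ, E) (c i) x v • frame x (b i) x := by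
    have h6 : ∀ i, mvfderiv 𝓘(ℝ, E) (c i) x v = l i (mvfderiv 𝓘(ℝ, E) (coord x Y) x v) :=
      fun i => mvfderiv_clm_comp (l i) hc v
    simp only [h6]
    have h7 : mvfderiv 𝓘(ℝ, E) (coord x Y) x v =
      ∑ i, l i (mvfderiv 𝓘(ℝ, E) (coord x Y) x v) • b i := (b.sum_repr _).symm
    conv_lhs => rw [h7]
    unfold frame
    rw [map_sum]
    simp only [map_smul]
  rw [h4, h5, sum_apply, add_comm, ← Finset.sum_add_distrib]
  exact Finset.sum_congr rfl fun i _ => h2 i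

end ConnectionLemmas

/-! ### The algebraic core: Bianchi identity against closedness. -/

section SkewAlgebra

/-- If the covariant derivative `A` of a `3`-form `T` satisfies the first Bianchi identity of a
connection with skew torsion `T`, and `T` is closed, then `A` and the quadratic expression
`∑ T(τ(a, b), c, d)` vanish. Here `B` stands for the derivatives of the components of `T` and `G`
for the Christoffel symbols. -/
lemma eq_zero_of_bianchi_of_closed {V : Type*} [AddCommGroup V] {T : V → V → V → ℝ}
    {A B : V → V → V → V → ℝ} {G : V → V → V}
    (hsub : ∀ u u' v w, T (u - u') v w = T u v w - T u' v w)
    (h12 : ∀ u v w, T u v w = -T v u w) (h23 : ∀ u v w, T u v w = -T u w v)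
    (hpair : ∀ a b c d, T (G a b - G b a) c d = T (G c d - G d c) a b)
    (hA : ∀ v a b c, A v a b c = B v a b c - T (G v a) b c - T a (G v b) c - T a b (G v c))
    (hA12 : ∀ v a b c, A v a b c = -A v b a c) (hA23 : ∀ v a b c, A v a b c = -A v a c b)
    (hBianchi : ∀ a b c d, A a b c d + A b c a d + A c a b d =
      -(T (G a b - G b a) c d + T (G b c - G c b) a d + T (G c a - G a c) b d))
    (hclosed : ∀ a b c d, B a b c d - B b a c d + B c a b d - B d a b c = 0) :
    (∀ a b c d, A a b c d = 0) ∧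
    ∀ a b c d, T (G a b - G b a) c d + T (G b c - G c b) a d + T (G c a - G a c) b d = 0 := by
  -- Pair symmetry makes the cyclic sum skew in `c` and `d` too, hence a 4-form.
  have hP : ∀ a b c d, T (G a b - G b a) c d + T (G b c - G c b) a d + T (G c a - G a c) b d =
      -(T (G a b - G b a) d c + T (G b d - G d b) a c + T (G d a - G a d) b c) := by
    intro a b c d
    have e1 := h23 (G a b - G b a) c d
    have e2 := hpair b c a d
    have e3 := hpair c a b d
    have e4 : T (G a d - G d a) b c = -T (G d a - G a d) b c := by
      rw [hsub, hsub]; ring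
    have e5 := h23 (G b d - G d b) c a
    linarith
  -- Adding the Bianchi identities for `(a, b, c, d)` and `(a, b, d, c)`, everything else cancels.
  -- Together with skewness in the last three slots this makes `A` totally skew.
  have hsw : ∀ a b c d, A c a b d = -A d a b c := by
    intro a b c d
    have e1 := hBianchi a b c d
    have e2 := hBianchi a b d c
    have e3 := hP a b c d
    have e4 := hA23 a b c d
    have e5 : A b c a d = -A b d a c := by
      rw [hA12 b c a d, hA23 b a c d, hA12 b a d c]; ring
    linarith
  have hfst : ∀ a b c d, A a b c d = -A b a c d := by
    intro a b c d
    rw [hA23 a b c d, hA12 a b d c, hA23 a d b c, hA12 a d c b]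
    rw [hA23 b a c d, hA12 b a d c, hA23 b d a c, hA12 b d c a]
    have := hsw c d a b
    have e1 := hA12 a d c b
    have e2 := hA12 b d c a
    linarith
  have hrot : ∀ a b c d, A b c a d = A a b c d := by
    intro a b c d
    rw [hA12 b c a d, hfst b a c d]; ring
  have h3A : ∀ a b c d, 3 * A a b c d =
      -(T (G a b - G b a) c d + T (G b c - G c b) a d + T (G c a - G a c) b d) := by
    intro a b c d
    have e1 := hBianchi a b c d
    have e2 := hrot a b c d
    have e3 := hrot b c a d
    linarith
  -- Write `P` for the cyclic sum. Expanding `hclosed` with `hA`, the Christoffel terms pair up into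
  -- torsions and closedness becomes `4A + 2P = 0`; since `P = -3A`, this is `-2A = 0`.
  have h4A : ∀ a b c d, A a b c d = 0 := by
    intro a b c d
    have e0 := hclosed a b c d
    have e1 := hA a b c d
    have e2 := hA b a c d
    have e3 := hA c a b d
    have e4 := hA d a b c
    have f2 := hfst a b c d
    have f3 := (hrot c a b d).symm
    have f4 : A d a b c = -A a b c d := by
      have := hsw a b c d
      have := hrot b c a d
      have := hrot a b c d
      linarith
    have e5 := h3A a b c d
    have hcyc : ∀ u v w, T u v w = T v w u := fun u v w => by
      rw [h12 u v w, h23 v u w]; ring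
    have t1 := hsub (G a b) (G b a) c d
    have t2 := hsub (G c a) (G a c) b d
    have t3 := hsub (G a d) (G d a) b c
    have t4 := hsub (G b c) (G c b) a d
    have t5 := hsub (G b d) (G d b) a c
    have t6 := hsub (G c d) (G d c) a b
    have p1 := hpair a b c d
    have p2 := hpair c a b d
    have p3 := hpair b c a d
    have p4 := h23 (G b d - G d b) c a
    have s3 : ∀ u v w, T u v w = T w u v := fun u v w => (hcyc w u v).symm
    have r1 := h12 b (G a c) d
    have r2 := s3 b c (G a d)
    have r3 := h12 a (G b c) d
    have r4 := s3 a c (G b d)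
    have r5 := h12 a (G c b) d
    have r6 := s3 a b (G c d)
    have r7 := h12 a (G d b) c
    have r8 := s3 a b (G d c)
    linarith
  refine ⟨h4A, fun a b c d => ?_⟩
  have := h3A a b c d
  rw [h4A] at this
  linarith

end SkewAlgebra

/-! ### Coordinate extensions of tangent vectors. -/

section CoordExt

variable [IsManifold 𝓘(ℂ, E) ω M]

/-- The extension of a tangent vector to a vector field with constant components in the preferred
chart. -/
def coordExt {x : M} (u : TangentSpace 𝓘(ℝ, E) x) : VField E M := frame (E := E) x u

@[simp] lemma coordExt_self {x : M} (u : TangentSpace 𝓘(ℝ, E) x) : coordExt u x = u :=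
  frame_self (E := E) x u

lemma smoothAt_coordExt_self {x : M} (u : TangentSpace 𝓘(ℝ, E) x) : SmoothAt (coordExt u) x :=
  smoothAt_frame (mem_chart_source E x) u

lemma diffAt_coordExt {x : M} (u : TangentSpace 𝓘(ℝ, E) x) : DiffAt (coordExt u) x :=
  (smoothAt_coordExt_self u).diffAt

lemma J_coordExt {x y : M} (hy : y ∈ (chartAt E x).source) (u : TangentSpace 𝓘(ℝ, E) x) :
    J y (coordExt u y) = coordExt (J x u) y :=
  J_frame hy u

variable [FiniteDimensional ℂ E]

lemma mlieBracket_coordExt {x y : M} (hy : y ∈ (chartAt E x).source)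
    (u v : TangentSpace 𝓘(ℝ, E) x) :
    VectorField.mlieBracket 𝓘(ℝ, E) (coordExt u) (coordExt v) y = 0 :=
  have : CompleteSpace E := FiniteDimensional.complete ℂ E
  mlieBracket_frame hy u v

lemma torsion_coordExt (D : Connection E M) {x y : M} (hy : y ∈ (chartAt E x).source)
    (u v : TangentSpace 𝓘(ℝ, E) x) :
    D.torsion y (coordExt u y) (coordExt v y) =
      D (coordExt v) y (coordExt u y) - D (coordExt u) y (coordExt v y) :=
  torsion_frame D hy u v

lemma d_apply_coordExt {k : ℕ} {α : Form E M k} {x : M} (h : SmoothComponents α x x)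
    (v : Fin (k + 1) → TangentSpace 𝓘(ℝ, E) x) :
    d α x v = ∑ i, (-1) ^ i.val •
      mvfderiv 𝓘(ℝ, E) (fun z => α z (fun j => coordExt (i.removeNth v j) z)) x (v i) :=
  d_apply h v

end CoordExt

/-! ### The Bianchi identity as an identity for the torsion. -/

section Torsion

variable [IsManifold 𝓘(ℂ, E) ω M] [FiniteDimensional ℂ E]

lemma torsion_smooth_coordExt [T2Space M] {D : Connection E M}
    (hD : D.ContMDiffCovariantDerivative ∞)
    {x y : M} (hy : y ∈ (chartAt E x).source) (u v : TangentSpace 𝓘(ℝ, E) x) :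
    SmoothAt (fun z => D.torsion z (coordExt u z) (coordExt v z)) y :=
  smoothAt_torsionFrame hD hy u v

lemma cov_sub (D : Connection E M) {X Y : VField E M} {x : M} (hX : DiffAt X x) (hY : DiffAt Y x) :
    D (fun y => X y - Y y) x = D X x - D Y x := by
  have h := cov_add D (hX.sub hY) hY
  simp only [sub_add_cancel] at h
  exact eq_sub_of_add_eq h.symm

/-- The first Bianchi identity, expressed through the derivatives of the torsion. -/
lemma FirstBianchi.sum_cov_torsion [T2Space M] {D : Connection E M}
    (hD : D.ContMDiffCovariantDerivative ∞)
    (hB : FirstBianchi D) {x : M} (a b c : TangentSpace 𝓘(ℝ, E) x) :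
    D (fun y => D.torsion y (coordExt b y) (coordExt c y)) x a +
      D (fun y => D.torsion y (coordExt c y) (coordExt a y)) x b +
      D (fun y => D.torsion y (coordExt a y) (coordExt b y)) x c = 0 := by
  have hx := mem_chart_source E x
  have h := hB x (coordExt a) (coordExt b) (coordExt c) (smoothAt_coordExt_self a)
    (smoothAt_coordExt_self b) (smoothAt_coordExt_self c)
  have hd : ∀ u v : TangentSpace 𝓘(ℝ, E) x, DiffAt (fun y => D (coordExt v) y (coordExt u y)) x :=
    fun u v => (smoothAt_cov_frame hD hx u v).diffAt
  have hsplit : ∀ u v w : TangentSpace 𝓘(ℝ, E) x,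
      D (fun y => D.torsion y (coordExt u y) (coordExt v y)) x w =
        D (fun y => D (coordExt v) y (coordExt u y)) x w -
          D (fun y => D (coordExt u) y (coordExt v y)) x w := by
    intro u v w
    have h1 : D (fun y => D.torsion y (coordExt u y) (coordExt v y)) x =
        D (fun y => D (coordExt v) y (coordExt u y) - D (coordExt u) y (coordExt v y)) x := by
      refine cov_congr D (torsion_smooth_coordExt hD hx u v).diffAt ((hd u v).sub (hd v u)) ?_
      filter_upwards [source_mem_nhds hx] with y hy using torsion_coordExt D hy u v
    rw [h1, cov_sub D (hd u v) (hd v u)]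
    rfl
  unfold curvature at h
  -- With the bracket terms gone, the six second derivatives regroup into derivatives of differences
  -- `∇_b C_c - ∇_c C_b`, which are torsions.
  simp only [mlieBracket_coordExt hx, map_zero, sub_zero, coordExt_self] at h
  rw [hsplit, hsplit, hsplit, ← h]
  abel

/-- The defining formula would differentiate `X` and `Y`, which are only differentiable at `x`.
Tensoriality avoids this: both fields are expanded in the coordinate frame, on which the torsion is
smooth. -/
lemma diffAt_torsion [T2Space M] {D : Connection E M} (hD : D.ContMDiffCovariantDerivative ∞)
    {X Y : VField E M} {x : M} (hX : DiffAt X x) (hY : DiffAt Y x) :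
    DiffAt (fun y => D.torsion y (X y) (Y y)) x := by
  have hx := mem_chart_source E x
  let b := Module.finBasis ℝ E
  let l : Fin (Module.finrank ℝ E) → E →L[ℝ] ℝ := fun i => (b.coord i).toContinuousLinearMap
  have hl : ∀ (Z : VField E M), DiffAt Z x → ∀ i,
      MDifferentiableAt 𝓘(ℝ, E) 𝓘(ℝ, ℝ) (fun y => l i (coord x Z y)) x := fun Z hZ i =>
    ((l i).contMDiff (n := 1)).contMDiffAt.mdifferentiableAt (by simp) |>.comp x
      ((diffAt_iff_coord hx Z).1 hZ)
  have hexp : ∀ (Z : VField E M), ∀ y ∈ (chartAt E x).source,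
      Z y = ∑ i, l i (coord x Z y) • frame x (b i) y := by
    intro Z y hy
    have h1 : coord x Z y = ∑ i, l i (coord x Z y) • b i := (b.sum_repr _).symm
    calc Z y = frame x (coord x Z y) y := (frame_coord hy Z).symm
      _ = frame x (∑ i, l i (coord x Z y) • b i) y := by rw [← h1]
      _ = _ := by
        unfold frame
        rw [map_sum]
        simp only [map_smul]
  have h := DiffAt.sum (x := x) (s := Finset.univ)
    (Y := fun i y => ∑ j, (l i (coord x X y) * l j (coord x Y y)) • torsionFrame D x (b i) (b j) y)
    fun i _ => DiffAt.sum fun j _ =>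
      diffAt_smul ((hl X hX i).mul (hl Y hY j)) (smoothAt_torsionFrame hD hx (b i) (b j)).diffAt
  refine h.congr ?_
  filter_upwards [source_mem_nhds hx] with y hy
  conv_lhs => rw [hexp X y hy, hexp Y y hy]
  simp only [map_sum, map_smul, sum_apply, smul_apply, Finset.smul_sum, smul_smul]
  rw [Finset.sum_comm]
  refine Finset.sum_congr rfl fun i _ => Finset.sum_congr rfl fun j _ => ?_
  simp only [mul_comm, torsionFrame]
  rfl

end Torsion

/-! ### Parallelism of the torsion form. -/

section TorsionForm

variable [IsManifold 𝓘(ℂ, E) ω M] [FiniteDimensional ℂ E]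

/-- The torsion tensor with lowered index, `T(u, v, w) = g(T(u, v), w)`. -/
def torsion₃ (g : Metric E M) (D : Connection E M) (x : M) (u v w : TangentSpace 𝓘(ℝ, E) x) : ℝ :=
  g.inner x (D.torsion x u v) w

lemma torsion₃_swap_left (g : Metric E M) (D : Connection E M) (x : M)
    (u v w : TangentSpace 𝓘(ℝ, E) x) : torsion₃ g D x u v w = -torsion₃ g D x v u w := by
  unfold torsion₃
  rw [D.torsion_antisymm, map_neg]
  rfl

lemma torsion₃_sub_left (g : Metric E M) (D : Connection E M) (x : M)
    (u u' v w : TangentSpace 𝓘(ℝ, E) x) :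
    torsion₃ g D x (u - u') v w = torsion₃ g D x u v w - torsion₃ g D x u' v w := by
  simp [torsion₃]

lemma torsion₃_sub_mid (g : Metric E M) (D : Connection E M) (x : M)
    (u v v' w : TangentSpace 𝓘(ℝ, E) x) :
    torsion₃ g D x u (v - v') w = torsion₃ g D x u v w - torsion₃ g D x u v' w := by
  simp [torsion₃]

lemma torsion₃_sub_right (g : Metric E M) (D : Connection E M) (x : M)
    (u v w w' : TangentSpace 𝓘(ℝ, E) x) :
    torsion₃ g D x u v (w - w') = torsion₃ g D x u v w - torsion₃ g D x u v w' := by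
  simp [torsion₃]

variable {g : Metric E M} {D D' : Connection E M}

lemma IsBismut.swap_right (h : IsBismut g D) (x : M)
    (u v w : TangentSpace 𝓘(ℝ, E) x) : torsion₃ g D x u v w = -torsion₃ g D x u w v :=
  h.skew x u v w

lemma IsBismut.cycle (h : IsBismut g D) (x : M)
    (u v w : TangentSpace 𝓘(ℝ, E) x) : torsion₃ g D x u v w = torsion₃ g D x v w u := by
  rw [torsion₃_swap_left, h.swap_right, neg_neg]

lemma torsionForm_apply (h : IsBismut g D) (x : M) (v : Fin 3 → TangentSpace 𝓘(ℝ, E) x) :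
    torsionForm h x v = torsion₃ g D x (v 0) (v 1) (v 2) := rfl

/-- Both sides are the inner product of `D.torsion x a b` and `D.torsion x c d`. -/
lemma IsBismut.torsion_pair_symm (h : IsBismut g D) (x : M) (a b c d : TangentSpace 𝓘(ℝ, E) x) :
    torsion₃ g D x (D.torsion x a b) c d = torsion₃ g D x (D.torsion x c d) a b := by
  rw [h.cycle, h.cycle x (D.torsion x c d)]
  exact g.symm x _ _

/-- The covariant derivative `(∇'_v T)(X, Y, Z)` of the torsion form `T` of `D` along another
connection `D'`. -/
def covTorsion (g : Metric E M) (D D' : Connection E M) {x : M} (v : TangentSpace 𝓘(ℝ, E) x)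
    (X Y Z : VField E M) : ℝ :=
  mvfderiv 𝓘(ℝ, E) (fun y => torsion₃ g D y (X y) (Y y) (Z y)) x v
    - torsion₃ g D x (D' X x v) (Y x) (Z x) - torsion₃ g D x (X x) (D' Y x v) (Z x)
    - torsion₃ g D x (X x) (Y x) (D' Z x v)

lemma mvfderiv_fun_neg' {f : M → ℝ} {x : M} (v : TangentSpace 𝓘(ℝ, E) x) :
    mvfderiv 𝓘(ℝ, E) (fun y => -f y) x v = -mvfderiv 𝓘(ℝ, E) f x v := by
  rw [mvfderiv_fun_neg]
  rfl

lemma covTorsion_swap_left {x : M} (v : TangentSpace 𝓘(ℝ, E) x) (X Y Z : VField E M) :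
    covTorsion g D D' v X Y Z = -covTorsion g D D' v Y X Z := by
  unfold covTorsion
  have h : (fun y => torsion₃ g D y (X y) (Y y) (Z y)) =
      fun y => -torsion₃ g D y (Y y) (X y) (Z y) :=
    funext fun y => torsion₃_swap_left g D y _ _ _
  rw [h, mvfderiv_fun_neg', torsion₃_swap_left g D x (D' X x v),
    torsion₃_swap_left g D x (X x) (D' Y x v), torsion₃_swap_left g D x (X x) (Y x)]
  ring

lemma IsBismut.covTorsion_swap_right (hB : IsBismut g D) {x : M} (v : TangentSpace 𝓘(ℝ, E) x)
    (X Y Z : VField E M) :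
    covTorsion g D D' v X Y Z = -covTorsion g D D' v X Z Y := by
  unfold covTorsion
  have h : (fun y => torsion₃ g D y (X y) (Y y) (Z y)) =
      fun y => -torsion₃ g D y (X y) (Z y) (Y y) :=
    funext fun y => hB.swap_right y _ _ _
  rw [h, mvfderiv_fun_neg', hB.swap_right x (D' X x v),
    hB.swap_right x (X x) (D' Y x v), hB.swap_right x (X x) (Y x)]
  ring

variable [T2Space M]

/-- For a metric connection, `∇' T` is the covariant derivative of the torsion operator. -/
lemma covTorsion_eq_inner (hD : D.ContMDiffCovariantDerivative ∞) (hm : IsMetric g D') {x : M}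
    (v : TangentSpace 𝓘(ℝ, E) x) {X Y Z : VField E M} (hX : DiffAt X x) (hY : DiffAt Y x)
    (hZ : DiffAt Z x) :
    covTorsion g D D' v X Y Z =
      g.inner x (D' (fun y => D.torsion y (X y) (Y y)) x v) (Z x)
        - torsion₃ g D x (D' X x v) (Y x) (Z x) - torsion₃ g D x (X x) (D' Y x v) (Z x) := by
  have h := hm x _ Z (diffAt_torsion hD hX hY) hZ v
  unfold covTorsion
  have h2 : mvfderiv 𝓘(ℝ, E) (fun y => torsion₃ g D y (X y) (Y y) (Z y)) x v = _ := h
  rw [h2]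
  simp only [torsion₃]
  ring

/-- A metric connection satisfying `∇' T = 0` on coordinate fields satisfies it on all fields. -/
lemma IsBismut.covTorsion_eq_zero (hB : IsBismut g D) (hm : IsMetric g D') {x : M}
    (v : TangentSpace 𝓘(ℝ, E) x)
    (h0 : ∀ a b c : TangentSpace 𝓘(ℝ, E) x,
      covTorsion g D D' v (coordExt a) (coordExt b) (coordExt c) = 0)
    {X Y Z : VField E M} (hX : DiffAt X x) (hY : DiffAt Y x) (hZ : DiffAt Z x) :
    covTorsion g D D' v X Y Z = 0 := by
  -- `covTorsion_eq_inner` contains no derivative of `Z`, so the last slot matters only through its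
  -- value at `x`; cyclic symmetry carries this to the other slots.
  have key : ∀ {X Y Z : VField E M}, DiffAt X x → DiffAt Y x → DiffAt Z x →
      covTorsion g D D' v X Y Z = covTorsion g D D' v X Y (coordExt (Z x)) := by
    intro X Y Z hX hY hZ
    rw [covTorsion_eq_inner hB.smooth hm v hX hY hZ,
      covTorsion_eq_inner hB.smooth hm v hX hY (diffAt_coordExt _), coordExt_self]
  have hcyc : ∀ X Y Z : VField E M, covTorsion g D D' v X Y Z = covTorsion g D D' v Y Z X := by
    intro X Y Z
    rw [covTorsion_swap_left, hB.covTorsion_swap_right, neg_neg]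
  have hc : ∀ u : TangentSpace 𝓘(ℝ, E) x, DiffAt (coordExt u) x := diffAt_coordExt
  rw [key hX hY hZ, hcyc, key hY (hc _) hX, hcyc, key (hc _) (hc _) hY, h0]

lemma IsBismut.smoothComponents_torsionForm (hB : IsBismut g D) {x₀ y : M}
    (hy : y ∈ (chartAt E x₀).source) : SmoothComponents (torsionForm hB) x₀ y := fun v =>
  smoothAt_inner g (smoothAt_torsionFrame hB.smooth hy (v 0) (v 1)) (smoothAt_frame hy (v 2))

lemma IsBismut.d_torsionForm_apply (hB : IsBismut g D) {x : M}
    (a b c e : TangentSpace 𝓘(ℝ, E) x) :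
    d (torsionForm hB) x ![a, b, c, e] =
      mvfderiv 𝓘(ℝ, E)
        (fun y => torsion₃ g D y (coordExt b y) (coordExt c y) (coordExt e y)) x a
      - mvfderiv 𝓘(ℝ, E)
        (fun y => torsion₃ g D y (coordExt a y) (coordExt c y) (coordExt e y)) x b
      + mvfderiv 𝓘(ℝ, E)
        (fun y => torsion₃ g D y (coordExt a y) (coordExt b y) (coordExt e y)) x c
      - mvfderiv 𝓘(ℝ, E)
        (fun y => torsion₃ g D y (coordExt a y) (coordExt b y) (coordExt c y)) x e := by
  rw [d_apply_coordExt (hB.smoothComponents_torsionForm (mem_chart_source E x))]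
  refine (Fin.sum_univ_four _).trans ?_
  have h : ∀ p q r s : ℝ, (-1 : ℤ) ^ 0 • p + (-1 : ℤ) ^ 1 • q + (-1 : ℤ) ^ 2 • r +
      (-1 : ℤ) ^ 3 • s = p - q + r - s := by
    intro p q r s
    norm_num
    ring
  exact h _ _ _ _

/-- A closed Bismut torsion of a connection satisfying the first Bianchi identity is parallel on
coordinate fields, and the cyclic sum of `T(T(a, b), c, d)` vanishes. -/
lemma IsBismut.covTorsion_eq_zero_of_closed (hB : IsBismut g D) (hBi : FirstBianchi D)
    (hd : d (torsionForm hB) = 0) (x : M) :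
    (∀ v a b c : TangentSpace 𝓘(ℝ, E) x,
      covTorsion g D D v (coordExt a) (coordExt b) (coordExt c) = 0) ∧
    ∀ a b c e : TangentSpace 𝓘(ℝ, E) x,
      torsion₃ g D x (D.torsion x a b) c e + torsion₃ g D x (D.torsion x b c) a e +
        torsion₃ g D x (D.torsion x c a) b e = 0 := by
  have hx := mem_chart_source E x
  have hτ : ∀ a b : TangentSpace 𝓘(ℝ, E) x,
      D.torsion x a b = D (coordExt b) x a - D (coordExt a) x b := by
    intro a b
    have := torsion_coordExt D hx a b
    simpa only [coordExt_self] using this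
  have h := eq_zero_of_bianchi_of_closed (T := torsion₃ g D x)
    (A := fun v a b c => covTorsion g D D v (coordExt a) (coordExt b) (coordExt c))
    (B := fun v a b c => mvfderiv 𝓘(ℝ, E)
      (fun y => torsion₃ g D y (coordExt a y) (coordExt b y) (coordExt c y)) x v)
    (G := fun a b => D (coordExt b) x a)
    (torsion₃_sub_left g D x) (torsion₃_swap_left g D x) (hB.swap_right x)
    (fun a b c e => by simpa only [hτ] using hB.torsion_pair_symm x a b c e)
    (fun v a b c => by simp only [covTorsion, coordExt_self])
    (fun v a b c => covTorsion_swap_left v _ _ _)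
    (fun v a b c => hB.covTorsion_swap_right v _ _ _)
    (fun a b c e => by
      have h1 := congrArg (fun u => g.inner x u e) (hBi.sum_cov_torsion hB.smooth a b c)
      simp only [map_add, add_apply, map_zero, zero_apply] at h1
      rw [covTorsion_eq_inner hB.smooth hB.metric a (diffAt_coordExt b) (diffAt_coordExt c)
        (diffAt_coordExt e),
        covTorsion_eq_inner hB.smooth hB.metric b (diffAt_coordExt c) (diffAt_coordExt a)
        (diffAt_coordExt e),
        covTorsion_eq_inner hB.smooth hB.metric c (diffAt_coordExt a) (diffAt_coordExt b)
        (diffAt_coordExt e)]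
      simp only [coordExt_self, torsion₃_sub_left]
      rw [torsion₃_swap_left g D x b (D (coordExt c) x a),
        torsion₃_swap_left g D x c (D (coordExt a) x b),
        torsion₃_swap_left g D x a (D (coordExt b) x c)]
      linarith)
    (fun a b c e => by
      have h1 := hB.d_torsionForm_apply a b c e
      rw [hd] at h1
      exact h1.symm)
  exact ⟨h.1, fun a b c e => by simpa only [hτ] using h.2 a b c e⟩

/-- The Levi-Civita connection is the Bismut connection minus half of its torsion. -/
lemma IsBismut.leviCivita_eq (hB : IsBismut g D) (hL : IsLeviCivita g D') {X : VField E M} {x : M}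
    (hX : DiffAt X x) (v : TangentSpace 𝓘(ℝ, E) x) :
    D' X x v = D X x v - (2⁻¹ : ℝ) • D.torsion x v (X x) := by
  have hx := mem_chart_source E x
  let S := fun u : TangentSpace 𝓘(ℝ, E) x => D.difference D' x u
  have hS : ∀ {Y : VField E M}, DiffAt Y x → ∀ w, S (Y x) w = D Y x w - D' Y x w := by
    intro Y hY w
    have := IsCovariantDerivativeOn.difference_apply D.isCovariantDerivativeOnUniv
      D'.isCovariantDerivativeOnUniv (Set.mem_univ x) hY
    exact congrArg (fun L => L w) this
  have hS' : ∀ u w : TangentSpace 𝓘(ℝ, E) x, S u w = D (coordExt u) x w - D' (coordExt u) x w := by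
    intro u w
    simpa only [coordExt_self] using hS (diffAt_coordExt u) w
  have hτ : ∀ a b : TangentSpace 𝓘(ℝ, E) x, D.torsion x a b = S b a - S a b := by
    intro a b
    have h1 := torsion_coordExt D hx a b
    have h2 := torsion_coordExt D' hx a b
    rw [hL.torsion] at h2
    simp only [coordExt_self] at h1 h2
    have h3 : D' (coordExt b) x a = D' (coordExt a) x b := (sub_eq_zero.1 h2.symm)
    rw [h1, hS', hS', h3]
    abel
  have hskew : ∀ a b c : TangentSpace 𝓘(ℝ, E) x, g.inner x (S a c) b = -g.inner x (S b c) a := by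
    intro a b c
    have h1 := hB.metric x _ _ (diffAt_coordExt a) (diffAt_coordExt b) c
    have h2 := hL.metric x _ _ (diffAt_coordExt a) (diffAt_coordExt b) c
    rw [h1] at h2
    simp only [coordExt_self] at h2
    rw [hS', hS']
    simp only [map_sub, sub_apply]
    rw [g.symm x _ (D (coordExt b) x c), g.symm x _ (D' (coordExt b) x c)] at h2
    linarith
  -- Koszul's argument: `S` is skew for the metric by `hskew`, and its antisymmetrisation is the
  -- torsion, so the total skewness of the torsion determines `S`.
  have key : ∀ u : TangentSpace 𝓘(ℝ, E) x, S u v = (2⁻¹ : ℝ) • D.torsion x v u := by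
    intro u
    refine g.eq_of_inner_eq fun w => ?_
    have e1 := hB.skew x v u w
    have e2 := hB.cycle x v u w
    simp only [torsion₃] at e2
    simp only [map_smul, smul_apply, smul_eq_mul]
    have f1 : g.inner x (D.torsion x v u) w = g.inner x (S u v) w - g.inner x (S v u) w := by
      rw [hτ]; simp
    have f2 : g.inner x (D.torsion x u w) v = g.inner x (S w u) v - g.inner x (S u w) v := by
      rw [hτ]; simp
    have f3 : g.inner x (D.torsion x v w) u = g.inner x (S w v) u - g.inner x (S v w) u := by
      rw [hτ]; simp
    have s1 := hskew u w v
    have s2 := hskew u v w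
    have s3 := hskew v w u
    linarith
  have h := hS hX v
  rw [key] at h
  rw [h]
  abel

/-- Passing from the Bismut to the Levi-Civita connection does not change `∇ T` if the quadratic
torsion term vanishes. -/
lemma IsBismut.covTorsion_leviCivita (hB : IsBismut g D) (hL : IsLeviCivita g D')
    {X Y Z : VField E M} {x : M} (hX : DiffAt X x) (hY : DiffAt Y x) (hZ : DiffAt Z x)
    (v : TangentSpace 𝓘(ℝ, E) x)
    (hP : ∀ a b c e : TangentSpace 𝓘(ℝ, E) x,
      torsion₃ g D x (D.torsion x a b) c e + torsion₃ g D x (D.torsion x b c) a e +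
        torsion₃ g D x (D.torsion x c a) b e = 0) :
    covTorsion g D D' v X Y Z = covTorsion g D D v X Y Z := by
  have hsm1 : ∀ (r : ℝ) (a b c : TangentSpace 𝓘(ℝ, E) x),
      torsion₃ g D x (r • a) b c = r * torsion₃ g D x a b c := by
    intro r a b c; simp [torsion₃]
  unfold covTorsion
  rw [hB.leviCivita_eq hL hX, hB.leviCivita_eq hL hY, hB.leviCivita_eq hL hZ,
    torsion₃_sub_left, torsion₃_sub_mid, torsion₃_sub_right, hsm1,
    torsion₃_swap_left g D x (X x) ((2⁻¹ : ℝ) • _), hsm1,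
    hB.cycle x (X x) (Y x) ((2⁻¹ : ℝ) • _), hB.cycle x (Y x) ((2⁻¹ : ℝ) • _), hsm1]
  -- The three corrections add up to one half of this quadratic sum, after pair symmetry exchanges
  -- `τ(v, Z)` for `τ(X, Y)`.
  have h1 := hP v (X x) (Y x) (Z x)
  have h2 := hB.torsion_pair_symm x v (Z x) (X x) (Y x)
  have h3 : torsion₃ g D x (D.torsion x (Y x) v) (X x) (Z x) =
      -torsion₃ g D x (D.torsion x v (Y x)) (X x) (Z x) := by
    rw [D.torsion_antisymm]
    simp [torsion₃]
  have h4 := hB.torsion_pair_symm x (X x) (Y x) v (Z x)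
  linarith

lemma IsBismut.isParallel_torsionForm_of_covTorsion (hB : IsBismut g D) (h : ∀ (x : M)
      (v : TangentSpace 𝓘(ℝ, E) x) (X Y Z : VField E M), DiffAt X x → DiffAt Y x → DiffAt Z x →
      covTorsion g D D' v X Y Z = 0) : IsParallel D' (torsionForm hB) := by
  intro x Y hY v
  have h1 := h x v (Y 0) (Y 1) (Y 2) (hY 0) (hY 1) (hY 2)
  unfold covTorsion at h1
  simp only [torsionForm_apply, Fin.sum_univ_three]
  simp
  linarith

/-- If the Bismut connection satisfies the first Bianchi identity and its torsion is closed, then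
the torsion is parallel for the Levi-Civita connection. -/
theorem IsBismut.isParallel_torsionForm (hB : IsBismut g D) (hBi : FirstBianchi D)
    (hd : d (torsionForm hB) = 0) (hL : IsLeviCivita g D') : IsParallel D' (torsionForm hB) := by
  refine hB.isParallel_torsionForm_of_covTorsion fun x v X Y Z hX hY hZ => ?_
  obtain ⟨h1, h2⟩ := hB.covTorsion_eq_zero_of_closed hBi hd x
  rw [hB.covTorsion_leviCivita hL hX hY hZ v h2]
  exact hB.covTorsion_eq_zero hB.metric v (h1 v) hX hY hZ

end TorsionForm

/-! ### Wedge products in low degree. -/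

section Wedge

lemma alternatization_fin_two {V : Type*} [AddCommGroup V] [Module ℝ V] [TopologicalSpace V]
    (f : ContinuousMultilinearMap ℝ (fun _ : Fin 2 => V) ℝ) (v : Fin 2 → V) :
    ContinuousMultilinearMap.alternatization f v = f v - f ![v 1, v 0] := by
  have hu : (Finset.univ : Finset (Equiv.Perm (Fin 2))) = {1, Equiv.swap 0 1} := by decide
  rw [ContinuousMultilinearMap.alternatization_apply_apply, hu]
  have h1 : (fun i => v ((Equiv.swap 0 1 : Equiv.Perm (Fin 2)) i)) = ![v 1, v 0] := by
    funext i; fin_cases i <;> rfl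
  rw [Finset.sum_pair (by decide)]
  simp [Function.comp_def, h1, sub_eq_add_neg]

lemma alternatization_fin_three {V : Type*} [AddCommGroup V] [Module ℝ V] [TopologicalSpace V]
    (f : ContinuousMultilinearMap ℝ (fun _ : Fin 3 => V) ℝ) (a b c : V) :
    ContinuousMultilinearMap.alternatization f ![a, b, c] =
      f ![a, b, c] - f ![b, a, c] - f ![c, b, a] - f ![a, c, b] + f ![b, c, a] + f ![c, a, b] := by
  have hu : (Finset.univ : Finset (Equiv.Perm (Fin 3))) =
      {1, Equiv.swap 0 1, Equiv.swap 0 2, Equiv.swap 1 2, Equiv.swap 0 1 * Equiv.swap 1 2,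
        Equiv.swap 1 2 * Equiv.swap 0 1} := by decide
  have h : ∀ (σ : Equiv.Perm (Fin 3)) (p q r : Fin 3), σ 0 = p → σ 1 = q → σ 2 = r →
      ![a, b, c] ∘ σ = ![![a, b, c] p, ![a, b, c] q, ![a, b, c] r] := by
    rintro σ _ _ _ rfl rfl rfl
    funext i
    fin_cases i <;> rfl
  rw [ContinuousMultilinearMap.alternatization_apply_apply, hu]
  repeat rw [Finset.sum_insert (by decide)]
  rw [Finset.sum_singleton, h 1 0 1 2 rfl rfl rfl, h (Equiv.swap 0 1) 1 0 2 rfl rfl rfl,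
    h (Equiv.swap 0 2) 2 1 0 rfl rfl rfl, h (Equiv.swap 1 2) 0 2 1 rfl rfl rfl,
    h (Equiv.swap 0 1 * Equiv.swap 1 2) 1 2 0 rfl rfl rfl,
    h (Equiv.swap 1 2 * Equiv.swap 0 1) 2 0 1 rfl rfl rfl]
  simp
  ring

lemma alternating_swap_two {V : Type*} [AddCommGroup V] [Module ℝ V] [TopologicalSpace V]
    (α : V [⋀^Fin 2]→L[ℝ] ℝ) (u v : V) : α ![u, v] = -α ![v, u] := by
  refine Eq.trans (congrArg α ?_)
    (α.toAlternatingMap.map_swap ![v, u] (zero_ne_one : (0 : Fin 2) ≠ 1))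
  funext i
  fin_cases i <;> rfl

/-- The two permutations contribute equally and cancel the factor `1 / 2!`. This is the power that
occurs in the Gauduchon condition on a surface. -/
lemma wedgePow_one (α : Form E M 2) : wedgePow α 1 = α := by
  funext x
  ext v
  have h : ContinuousMultilinearMap.alternatization
      (tensor (ContinuousAlternatingMap.constOfIsEmpty ℝ (TangentSpace 𝓘(ℝ, E) x) (Fin 0) 1)
        (α x)) v = 2 * α x v := by
    refine (alternatization_fin_two _ v).trans ?_
    have h1 : ∀ w : Fin 2 → TangentSpace 𝓘(ℝ, E) x,
        tensor (ContinuousAlternatingMap.constOfIsEmpty ℝ (TangentSpace 𝓘(ℝ, E) x) (Fin 0) 1)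
        (α x) w = α x w := by
      intro w
      refine (one_mul _).trans (congrArg (α x) (funext fun j => congrArg w ?_))
      fin_cases j <;> rfl
    have h2 : α x ![v 1, v 0] = -α x v := by
      rw [alternating_swap_two]
      congr 2
      funext i; fin_cases i <;> rfl
    rw [h1, h1, h2]
    ring
  refine (congrArg (fun t => ((Nat.factorial 0 * Nat.factorial 2 : ℝ))⁻¹ * t) h).trans ?_
  norm_num
  exact (by intro t; ring : ∀ t : ℝ, 1 / 2 * (2 * t) = t) _

lemma wedge_one_two_apply (θ : Form E M 1) (α : Form E M 2) (x : M)
    (a b c : TangentSpace 𝓘(ℝ, E) x) :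
    (wedge θ α : Form E M 3) x ![a, b, c] = θ x ![a] * α x ![b, c] + θ x ![b] * α x ![c, a] +
      θ x ![c] * α x ![a, b] := by
  have h := alternatization_fin_three (tensor (θ x) (α x)) a b c
  have h1 : ∀ u v w : TangentSpace 𝓘(ℝ, E) x,
      tensor (θ x) (α x) ![u, v, w] = θ x ![u] * α x ![v, w] := by
    intro u v w
    refine congrArg₂ (· * ·) (congrArg (θ x) ?_) (congrArg (α x) ?_)
    · funext i; fin_cases i; rfl
    · funext i; fin_cases i <;> rfl
  have h2 := alternating_swap_two (α x)
  refine (congrArg (fun t => ((Nat.factorial 1 * Nat.factorial 2 : ℝ))⁻¹ * t) h).trans ?_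
  rw [h1, h1, h1, h1, h1, h1, h2 a c, h2 b a, h2 c b]
  norm_num
  ring

end Wedge

/-! ### The fundamental form, integrability, and `d^c ω = T`. -/

section FundamentalForm

variable [IsManifold 𝓘(ℂ, E) ω M] [FiniteDimensional ℂ E] {g : Metric E M} {D : Connection E M}

lemma IsHermitian.inner_J_right (hg : IsHermitian g) (x : M) (v w : TangentSpace 𝓘(ℝ, E) x) :
    g.inner x v (J x w) = -g.inner x w (J x v) := by
  rw [← hg x v (J x w), J_J, map_neg, g.symm x w]

lemma smoothComponents_fundamentalForm (hg : IsHermitian g) {x₀ y : M}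
    (hy : y ∈ (chartAt E x₀).source) : SmoothComponents (fundamentalForm hg) x₀ y := fun v =>
  smoothAt_inner g (smoothAt_frame hy (v 0)) (smoothAt_frame hy (v 1)).J

lemma formJ_fundamentalForm (hg : IsHermitian g) :
    formJ (fundamentalForm hg) = fundamentalForm hg := by
  funext x
  ext v
  have h : g.inner x (-J x (v 0)) (J x (-J x (v 1))) = g.inner x (v 0) (J x (v 1)) := by
    rw [map_neg, map_neg, map_neg, neg_apply, neg_neg, hg]
  exact h

lemma torsion_eq_cov_sub (D : Connection E M) (x : M) (a b : TangentSpace 𝓘(ℝ, E) x) :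
    D.torsion x a b = D (coordExt b) x a - D (coordExt a) x b := by
  simpa only [coordExt_self] using torsion_coordExt D (mem_chart_source E x) a b

/-- For a Hermitian connection, `dω(a, b, c)` is the cyclic sum of `T(a, b, J c)`. -/
lemma d_fundamentalForm_apply (hg : IsHermitian g) (hm : IsMetric g D) (hc : IsComplex D) {x : M}
    (a b c : TangentSpace 𝓘(ℝ, E) x) :
    d (fundamentalForm hg) x ![a, b, c] =
      torsion₃ g D x a b (J x c) + torsion₃ g D x b c (J x a) + torsion₃ g D x c a (J x b) := by
  rw [d_apply_coordExt (smoothComponents_fundamentalForm hg (mem_chart_source E x))]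
  -- The fundamental form is parallel, so differentiating its components only differentiates the
  -- fields; alternation then turns these terms into torsions.
  have hder : ∀ u v w : TangentSpace 𝓘(ℝ, E) x,
      mvfderiv 𝓘(ℝ, E) (fun y => g.inner y (coordExt v y) (J y (coordExt w y))) x u =
        g.inner x (D (coordExt v) x u) (J x w) - g.inner x (D (coordExt w) x u) (J x v) := by
    intro u v w
    rw [hm x (coordExt v) (fun y => J y (coordExt w y)) (diffAt_coordExt v) (diffAt_coordExt w).J u,
      hc x _ (diffAt_coordExt w), coordExt_self, coordExt_self, hg.inner_J_right x v]
    ring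
  refine (Fin.sum_univ_three _).trans ?_
  have h : ∀ p q r : ℝ, (-1 : ℤ) ^ 0 • p + (-1 : ℤ) ^ 1 • q + (-1 : ℤ) ^ 2 • r = p - q + r := by
    intro p q r
    norm_num
    ring
  refine (h _ _ _).trans ?_
  refine Eq.trans (congrArg₂ (· + ·) (congrArg₂ (· - ·) (hder a b c) (hder b a c)) (hder c a b)) ?_
  simp only [torsion₃, torsion_eq_cov_sub, map_sub, sub_apply]
  ring

/-- The Nijenhuis tensor of `J`, expressed through the torsion of a complex connection,
vanishes. -/
lemma IsComplex.torsion_J_J (hc : IsComplex D) (x : M) (a b : TangentSpace 𝓘(ℝ, E) x) :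
    D.torsion x (J x a) (J x b) =
      J x (D.torsion x (J x a) b) + J x (D.torsion x a (J x b)) + D.torsion x a b := by
  -- Integrability enters here: `J` maps coordinate fields of a holomorphic chart to coordinate
  -- fields, so the Christoffel symbols of a complex connection commute with `J`.
  have hJ : ∀ u v : TangentSpace 𝓘(ℝ, E) x,
      D (coordExt (J x u)) x v = J x (D (coordExt u) x v) := by
    intro u v
    rw [← hc x _ (diffAt_coordExt u)]
    refine congrArg (fun L => L v) (cov_congr D (diffAt_coordExt _) (diffAt_coordExt u).J ?_)
    filter_upwards [source_mem_nhds (mem_chart_source E x)] with y hy using (J_coordExt hy u).symm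
  simp only [torsion_eq_cov_sub, hJ, map_sub, J_J]
  abel

/-- Integrability for the lowered torsion: `T` has no component of type (3,0) + (0,3). -/
lemma IsBismut.torsion₃_eq_sum_J (hB : IsBismut g D) (hg : IsHermitian g) (x : M)
    (a b c : TangentSpace 𝓘(ℝ, E) x) :
    torsion₃ g D x a b c = torsion₃ g D x (J x a) (J x b) c + torsion₃ g D x (J x b) (J x c) a +
      torsion₃ g D x (J x c) (J x a) b := by
  have h := congrArg (fun u => g.inner x u c) (hB.complex.torsion_J_J x a b)
  simp only [map_add, add_apply] at h
  have hJ : ∀ u v : TangentSpace 𝓘(ℝ, E) x, g.inner x (J x u) v = -g.inner x u (J x v) := by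
    intro u v
    rw [g.symm x, hg.inner_J_right]
  rw [hJ, hJ] at h
  have h1 := hB.cycle x (J x c) (J x a) b
  have h2 := hB.cycle x (J x a) b (J x c)
  have h3 := hB.cycle x a (J x b) (J x c)
  simp only [torsion₃] at *
  linarith

/-- The torsion form of the Bismut connection is `d^c ω`. -/
lemma IsBismut.dc_fundamentalForm (hB : IsBismut g D) (hg : IsHermitian g) :
    dc (fundamentalForm hg) = torsionForm hB := by
  funext x
  ext v
  have h0 : dc (fundamentalForm hg) x v =
      -d (fundamentalForm hg) x ![J x (v 0), J x (v 1), J x (v 2)] := by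
    unfold dc
    rw [formJ_fundamentalForm]
    refine congrArg (fun t : ℝ => -t) (congrArg (d (fundamentalForm hg) x) ?_)
    funext i
    fin_cases i <;> rfl
  rw [h0, d_fundamentalForm_apply hg hB.metric hB.complex, torsionForm_apply,
    hB.torsion₃_eq_sum_J hg x (v 0) (v 1) (v 2)]
  simp only [J_J, torsion₃, map_neg]
  ring

/-- On a complex surface the Gauduchon condition says that the Bismut torsion is closed. -/
lemma IsBismut.d_torsionForm_of_isGauduchon (hB : IsBismut g D) (hg : IsHermitian g)
    (h2 : Module.finrank ℂ E = 2) (h : IsGauduchon hg) : d (torsionForm hB) = 0 := by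
  -- The degree of the form depends on `finrank`, so the dimension is made a variable before
  -- substitution; at `n = 2` the degree `2 * (n - 1)` computes to `2`.
  have key : ∀ n, n = 2 → d (dc (wedgePow (fundamentalForm hg) (n - 1))) = 0 →
      d (torsionForm hB) = 0 := by
    rintro n rfl h
    rw [← hB.dc_fundamentalForm hg]
    have h1 := wedgePow_one (fundamentalForm hg)
    rw [← h1]
    exact h
  exact key _ h2 h

end FundamentalForm

/-! ### Traces of endomorphism fields and their derivatives. -/

section Trace

variable [IsManifold 𝓘(ℂ, E) ω M] [FiniteDimensional ℂ E]

lemma trace_eq_sum_coord {x₀ y : M} (hy : y ∈ (chartAt E x₀).source)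
    (A : ∀ z : M, TangentSpace 𝓘(ℝ, E) z →ₗ[ℝ] TangentSpace 𝓘(ℝ, E) z) :
    LinearMap.trace ℝ (TangentSpace 𝓘(ℝ, E) y) (A y) =
      ∑ i, (Module.finBasis ℝ E).coord i
        (coord x₀ (fun z => A z (frame x₀ (Module.finBasis ℝ E i) z)) y) := by
  let e : TangentSpace 𝓘(ℝ, E) y ≃ₗ[ℝ] E :=
    ((trivializationAt E (TangentSpace 𝓘(ℝ, E)) x₀).continuousLinearEquivAt ℝ y
      (mem_baseSet hy)).toLinearEquiv
  rw [← LinearMap.trace_conj' (A y) e, LinearMap.trace_eq_matrix_trace ℝ (Module.finBasis ℝ E),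
    Matrix.trace]
  refine Finset.sum_congr rfl fun i _ => ?_
  rw [Matrix.diag_apply, LinearMap.toMatrix_apply]
  have h1 : ∀ a : E, e.symm a = frame x₀ a y := fun a =>
    congrFun ((trivializationAt E (TangentSpace 𝓘(ℝ, E)) x₀).symm_continuousLinearEquivAt_eq
      (R := ℝ) (mem_baseSet hy)) a
  have h2 : ∀ u : TangentSpace 𝓘(ℝ, E) y, e u =
      (trivializationAt E (TangentSpace 𝓘(ℝ, E)) x₀).continuousLinearMapAt ℝ y u := fun u =>
    congrFun ((trivializationAt E (TangentSpace 𝓘(ℝ, E)) x₀).coe_continuousLinearEquivAt_eq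
      (R := ℝ) (mem_baseSet hy)) u
  rw [LinearEquiv.conj_apply_apply, h1, h2]
  rfl

lemma contMDiffAt_trace {x₀ y : M} (hy : y ∈ (chartAt E x₀).source)
    {A : ∀ z : M, TangentSpace 𝓘(ℝ, E) z →ₗ[ℝ] TangentSpace 𝓘(ℝ, E) z}
    (hA : ∀ a : E, SmoothAt (fun z => A z (frame x₀ a z)) y) :
    ContMDiffAt 𝓘(ℝ, E) 𝓘(ℝ, ℝ) ∞
      (fun z => LinearMap.trace ℝ (TangentSpace 𝓘(ℝ, E) z) (A z)) y := by
  let l : Fin (Module.finrank ℝ E) → E →L[ℝ] ℝ := fun i =>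
    ((Module.finBasis ℝ E).coord i).toContinuousLinearMap
  have h : ContMDiffAt 𝓘(ℝ, E) 𝓘(ℝ, ℝ) ∞ (fun y => ∑ i, l i
      (coord x₀ (fun z => A z (frame x₀ (Module.finBasis ℝ E i) z)) y)) y :=
    contMDiffAt_finsetSum fun i _ =>
      (l i).contMDiff.contMDiffAt.comp y ((smoothAt_iff_coord hy _).1 (hA _))
  refine h.congr_of_eventuallyEq ?_
  filter_upwards [source_mem_nhds hy] with z hz using trace_eq_sum_coord hz A

lemma mvfderiv_congr' {f f' : M → ℝ} {x : M} (h : f =ᶠ[𝓝 x] f') :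
    mvfderiv 𝓘(ℝ, E) f x = mvfderiv 𝓘(ℝ, E) f' x := by
  have h1 := h.eq_of_nhds
  have h2 := h.mfderiv_eq (I := 𝓘(ℝ, E)) (I' := 𝓘(ℝ, ℝ))
  ext v
  exact congrArg (fun L : E →L[ℝ] ℝ => L v) h2

lemma mdifferentiableAt_finsetSum {ι : Type*} {s : Finset ι} {f : ι → M → ℝ} {x : M}
    (hf : ∀ i ∈ s, MDifferentiableAt 𝓘(ℝ, E) 𝓘(ℝ, ℝ) (f i) x) :
    MDifferentiableAt 𝓘(ℝ, E) 𝓘(ℝ, ℝ) (fun y => ∑ i ∈ s, f i y) x := by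
  classical
  induction s using Finset.induction_on with
  | empty => exact mdifferentiableAt_const
  | insert a s ha ih =>
    simp only [Finset.sum_insert ha]
    exact (hf a (Finset.mem_insert_self a s)).add
      (ih fun i hi => hf i (Finset.mem_insert_of_mem hi))

lemma mvfderiv_sum {ι : Type*} (s : Finset ι) {f : ι → M → ℝ} {x : M}
    (hf : ∀ i ∈ s, MDifferentiableAt 𝓘(ℝ, E) 𝓘(ℝ, ℝ) (f i) x) (v : TangentSpace 𝓘(ℝ, E) x) :
    mvfderiv 𝓘(ℝ, E) (fun y => ∑ i ∈ s, f i y) x v = ∑ i ∈ s, mvfderiv 𝓘(ℝ, E) (f i) x v := by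
  classical
  induction s using Finset.induction_on with
  | empty => simp [mvfderiv_const]
  | insert a s ha ih =>
    simp only [Finset.sum_insert ha]
    have h := fun i hi => hf i (Finset.mem_insert_of_mem hi)
    rw [mvfderiv_fun_add (hf a (Finset.mem_insert_self a s)) (mdifferentiableAt_finsetSum h),
      ← ih h]
    rfl

/-- The Christoffel endomorphism `u ↦ ∇_v C_u` on coordinate fields. -/
def christoffel (D : Connection E M) {x : M} (v : TangentSpace 𝓘(ℝ, E) x) :
    TangentSpace 𝓘(ℝ, E) x →ₗ[ℝ] TangentSpace 𝓘(ℝ, E) x where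
  toFun u := D (coordExt u) x v
  map_add' u w := by
    have h : (coordExt (u + w) : VField E M) = fun y => coordExt u y + coordExt w y :=
      funext fun y => frame_add (E := E) x u w y
    rw [h, cov_add D (diffAt_coordExt u) (diffAt_coordExt w)]
    rfl
  map_smul' r u := by
    have h : (coordExt (r • u) : VField E M) = fun y => r • coordExt u y :=
      funext fun y => frame_smul (E := E) x r u y
    rw [h, cov_smul D mdifferentiableAt_const (diffAt_coordExt u), mvfderiv_const]
    simp

lemma mvfderiv_coord_eq (D : Connection E M) {Y : VField E M} {x : M} (hY : DiffAt Y x)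
    (v : TangentSpace 𝓘(ℝ, E) x) :
    mvfderiv 𝓘(ℝ, E) (coord x Y) x v = D Y x v - christoffel D v (Y x) := by
  rw [cov_eq_coord D hY v, frame_self]
  exact (add_sub_cancel_right _ _).symm

/-- The trace commutes with covariant differentiation. -/
lemma mvfderiv_trace (D : Connection E M) {x : M} (v : TangentSpace 𝓘(ℝ, E) x)
    {A : ∀ z : M, TangentSpace 𝓘(ℝ, E) z →ₗ[ℝ] TangentSpace 𝓘(ℝ, E) z}
    {B : TangentSpace 𝓘(ℝ, E) x →ₗ[ℝ] TangentSpace 𝓘(ℝ, E) x}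
    (hA : ∀ u : TangentSpace 𝓘(ℝ, E) x, DiffAt (fun z => A z (coordExt u z)) x)
    (hB : ∀ u : TangentSpace 𝓘(ℝ, E) x,
      D (fun z => A z (coordExt u z)) x v = A x (D (coordExt u) x v) + B u) :
    mvfderiv 𝓘(ℝ, E) (fun z => LinearMap.trace ℝ (TangentSpace 𝓘(ℝ, E) z) (A z)) x v =
      LinearMap.trace ℝ (TangentSpace 𝓘(ℝ, E) x) B := by
  have hx := mem_chart_source E x
  let b := Module.finBasis ℝ E
  let l : Fin (Module.finrank ℝ E) → E →L[ℝ] ℝ := fun i => (b.coord i).toContinuousLinearMap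
  let F : Fin (Module.finrank ℝ E) → VField E M := fun i z => A z (frame x (b i) z)
  have hF : ∀ i, DiffAt (F i) x := fun i => hA (b i)
  have hc : ∀ i, MDifferentiableAt 𝓘(ℝ, E) 𝓘(ℝ, E) (coord x (F i)) x := fun i =>
    (diffAt_iff_coord hx _).1 (hF i)
  have h1 : (fun z => LinearMap.trace ℝ (TangentSpace 𝓘(ℝ, E) z) (A z)) =ᶠ[𝓝 x]
      fun z => ∑ i, l i (coord x (F i) z) := by
    filter_upwards [source_mem_nhds hx] with z hz using trace_eq_sum_coord hz A
  have h2 := mvfderiv_sum (E := E) Finset.univ (f := fun i z => l i (coord x (F i) z)) (x := x)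
    (fun i _ => ((l i).contMDiff (n := 1)).contMDiffAt.mdifferentiableAt (by simp) |>.comp x (hc i))
    v
  rw [mvfderiv_congr' h1, h2]
  let Γ := christoffel D v
  have h3 : ∀ i, mvfderiv 𝓘(ℝ, E) (fun z => l i (coord x (F i) z)) x v =
      b.coord i ((A x ∘ₗ Γ + B - Γ ∘ₗ A x) (b i)) := by
    intro i
    rw [mvfderiv_clm_comp (l i) (hc i) v, mvfderiv_coord_eq D (hF i) v]
    refine congrArg (b.coord i) (congrArg₂ (· - ·) (hB (b i)) (congrArg Γ ?_))
    exact congrArg (A x) (frame_self x (b i))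
  rw [Finset.sum_congr rfl fun i _ => h3 i]
  -- The coordinate derivative of `A` differs from its covariant derivative `B` by a commutator with
  -- the Christoffel endomorphism, which has trace zero.
  have h4 : LinearMap.trace ℝ (TangentSpace 𝓘(ℝ, E) x) (A x ∘ₗ Γ + B - Γ ∘ₗ A x) =
      LinearMap.trace ℝ (TangentSpace 𝓘(ℝ, E) x) B := by
    have h5 := LinearMap.trace_mul_comm ℝ (A x) Γ
    rw [Module.End.mul_eq_comp, Module.End.mul_eq_comp] at h5
    rw [map_sub, map_add, h5]
    ring
  rw [← h4]
  exact ((LinearMap.trace_eq_matrix_trace ℝ b _).trans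
    (Finset.sum_congr rfl fun i _ => LinearMap.toMatrix_apply b b _ i i)).symm

end Trace

/-! ### The Lee form of a surface and the Vaisman property. -/

section LeeForm

variable [IsManifold 𝓘(ℂ, E) ω M] [FiniteDimensional ℂ E]

/-- The torsion of a connection as an algebraic bilinear map. -/
def torsionLin (D : Connection E M) (x : M) :
    TangentSpace 𝓘(ℝ, E) x →ₗ[ℝ] TangentSpace 𝓘(ℝ, E) x →ₗ[ℝ] TangentSpace 𝓘(ℝ, E) x where
  toFun u := (D.torsion x u).toLinearMap
  map_add' u v := by ext w; simp
  map_smul' r u := by ext w; simp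

/-- A Riemannian metric as an algebraic bilinear form. -/
def innerLin (g : Metric E M) (x : M) :
    TangentSpace 𝓘(ℝ, E) x →ₗ[ℝ] TangentSpace 𝓘(ℝ, E) x →ₗ[ℝ] ℝ where
  toFun u := (g.inner x u).toLinearMap
  map_add' u v := by ext w; simp
  map_smul' r u := by ext w; simp

/-- The Lee form of a connection at a point, as a linear form. -/
def leeLin (D : Connection E M) (x : M) : TangentSpace 𝓘(ℝ, E) x →ₗ[ℝ] ℝ :=
  halfTrace (torsionLin D x) (J x).toLinearMap

lemma continuous_leeLin (D : Connection E M) (x : M) : Continuous (leeLin D x) :=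
  let l : E →ₗ[ℝ] ℝ := leeLin D x
  l.continuous_of_finiteDimensional

/-- The Lee form of a connection. -/
def leeForm (D : Connection E M) : Form E M 1 := fun x =>
  ContinuousAlternatingMap.ofSubsingleton ℝ (TangentSpace 𝓘(ℝ, E) x) ℝ (0 : Fin 1)
    ⟨leeLin D x, continuous_leeLin D x⟩

lemma leeForm_apply (D : Connection E M) (x : M) (v : Fin 1 → TangentSpace 𝓘(ℝ, E) x) :
    leeForm D x v = leeLin D x (v 0) := rfl

/-- The endomorphism `u ↦ J (τ(J Y, u))` attached to a vector field. -/
def leeEnd (D : Connection E M) (x : M) (u : TangentSpace 𝓘(ℝ, E) x) :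
    TangentSpace 𝓘(ℝ, E) x →ₗ[ℝ] TangentSpace 𝓘(ℝ, E) x :=
  (J x).toLinearMap ∘ₗ torsionLin D x (J x u)

lemma leeEnd_apply (D : Connection E M) (x : M) (u w : TangentSpace 𝓘(ℝ, E) x) :
    leeEnd D x u w = J x (D.torsion x (J x u) w) := rfl

lemma leeLin_eq (D : Connection E M) (x : M) (u : TangentSpace 𝓘(ℝ, E) x) :
    leeLin D x u = (2⁻¹ : ℝ) * LinearMap.trace ℝ (TangentSpace 𝓘(ℝ, E) x) (leeEnd D x u) := rfl

lemma finrank_tangentSpace (h2 : Module.finrank ℂ E = 2) (x : M) :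
    Module.finrank ℝ (TangentSpace 𝓘(ℝ, E) x) = 4 := by
  have h : Module.finrank ℝ E = 4 := by rw [finrank_real_of_complex, h2]
  exact h

variable {g : Metric E M} {D D' : Connection E M}

lemma IsBismut.leeLin_torsion (hB : IsBismut g D) (hg : IsHermitian g)
    (h2 : Module.finrank ℂ E = 2) (x : M) (a b : TangentSpace 𝓘(ℝ, E) x) :
    leeLin D x (D.torsion x a b) = 0 :=
  halfTrace_torsion_eq_zero (g := innerLin g x) (finrank_tangentSpace h2 x) (g.symm x) (g.pos x)
    (J_J x) (hg x) (torsion₃_swap_left g D x) (hB.swap_right x) (hB.torsion₃_eq_sum_J hg x) a b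

lemma IsBismut.d_fundamentalForm_eq_wedge (hB : IsBismut g D) (hg : IsHermitian g)
    (h2 : Module.finrank ℂ E = 2) :
    d (fundamentalForm hg) = wedge (leeForm D) (fundamentalForm hg) := by
  funext x
  ext v
  have hv : v = ![v 0, v 1, v 2] := by
    funext i
    fin_cases i <;> rfl
  rw [hv]
  refine (d_fundamentalForm_apply hg hB.metric hB.complex _ _ _).trans
    (Eq.trans ?_ (wedge_one_two_apply (leeForm D) (fundamentalForm hg) x _ _ _).symm)
  exact sum_torsion_eq_wedge (g := innerLin g x) (finrank_tangentSpace h2 x) (g.symm x) (g.pos x)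
    (J_J x) (hg x) (torsion₃_swap_left g D x) (hB.swap_right x) _ _ _

variable [T2Space M]

lemma smoothComponents_leeForm (hD : D.ContMDiffCovariantDerivative ∞) {x₀ y : M}
    (hy : y ∈ (chartAt E x₀).source) : SmoothComponents (leeForm D) x₀ y := by
  intro v
  have h := contMDiffAt_trace hy (A := fun z => leeEnd D z (frame x₀ (v 0) z)) fun a => by
    refine ((smoothAt_torsionFrame hD hy (Complex.I • v 0) a).J).congr ?_
    filter_upwards [source_mem_nhds hy] with z hz
    rw [leeEnd_apply, J_frame hz]
    rfl
  exact (contMDiffAt_const (c := (2⁻¹ : ℝ))).mul h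

/-- As the metric is parallel, a parallel torsion form means a parallel torsion operator, hence a
Leibniz rule without extra term. -/
lemma IsBismut.cov_torsion (hB : IsBismut g D) {x : M} (v : TangentSpace 𝓘(ℝ, E) x)
    (h0 : ∀ a b c : TangentSpace 𝓘(ℝ, E) x,
      covTorsion g D D v (coordExt a) (coordExt b) (coordExt c) = 0)
    {X Y : VField E M} (hX : DiffAt X x) (hY : DiffAt Y x) :
    D (fun y => D.torsion y (X y) (Y y)) x v =
      D.torsion x (D X x v) (Y x) + D.torsion x (X x) (D Y x v) := by
  refine g.eq_of_inner_eq fun w => ?_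
  have h1 := hB.covTorsion_eq_zero hB.metric v h0 hX hY (diffAt_coordExt w)
  rw [covTorsion_eq_inner hB.smooth hB.metric v hX hY (diffAt_coordExt w), coordExt_self] at h1
  simp only [torsion₃] at h1
  rw [map_add, add_apply]
  linarith

/-- If the Bismut torsion is parallel, then so is the Lee form. -/
lemma IsBismut.mvfderiv_leeLin (hB : IsBismut g D) {x : M} (v : TangentSpace 𝓘(ℝ, E) x)
    (h0 : ∀ a b c : TangentSpace 𝓘(ℝ, E) x,
      covTorsion g D D v (coordExt a) (coordExt b) (coordExt c) = 0)
    {Y : VField E M} (hY : DiffAt Y x) :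
    mvfderiv 𝓘(ℝ, E) (fun y => leeLin D y (Y y)) x v = leeLin D x (D Y x v) := by
  have hτ : ∀ u : TangentSpace 𝓘(ℝ, E) x,
      DiffAt (fun z => D.torsion z (J z (Y z)) (coordExt u z)) x := fun u =>
    diffAt_torsion hB.smooth hY.J (diffAt_coordExt u)
  have hτJ : ∀ u : TangentSpace 𝓘(ℝ, E) x,
      DiffAt (fun z => leeEnd D z (Y z) (coordExt u z)) x := fun u => (hτ u).J
  have hlee : ∀ (z : M) (w : TangentSpace 𝓘(ℝ, E) z), leeLin D z w =
      LinearMap.trace ℝ (TangentSpace 𝓘(ℝ, E) z) ((2⁻¹ : ℝ) • leeEnd D z w) := fun z w => by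
    rw [map_smul, leeLin_eq, smul_eq_mul]
  simp only [hlee]
  refine mvfderiv_trace D v (A := fun z => (2⁻¹ : ℝ) • leeEnd D z (Y z))
    (fun u => diffAt_smul mdifferentiableAt_const (hτJ u)) fun u => ?_
  -- Both `J` and the torsion are parallel, so the derivative of `leeEnd` at `Y` is `leeEnd` at the
  -- derivative of `Y`.
  have h : D (fun z => leeEnd D z (Y z) (coordExt u z)) x v =
      leeEnd D x (Y x) (D (coordExt u) x v) + leeEnd D x (D Y x v) u := by
    simp only [leeEnd_apply]
    rw [hB.complex x _ (hτ u), hB.cov_torsion v h0 hY.J (diffAt_coordExt u),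
      hB.complex x _ hY, coordExt_self, map_add, add_comm]
  simp only [LinearMap.smul_apply]
  rw [cov_smul D mdifferentiableAt_const (hτJ u), mvfderiv_const, h, smul_add]
  simp

/-- If the Bismut torsion is parallel, the Lee form of a complex surface is parallel for the
Levi-Civita connection. -/
lemma IsBismut.mvfderiv_leeLin_leviCivita (hB : IsBismut g D) (hg : IsHermitian g)
    (h2 : Module.finrank ℂ E = 2) (hL : IsLeviCivita g D') {x : M} (v : TangentSpace 𝓘(ℝ, E) x)
    (h0 : ∀ a b c : TangentSpace 𝓘(ℝ, E) x,
      covTorsion g D D v (coordExt a) (coordExt b) (coordExt c) = 0)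
    {Y : VField E M} (hY : DiffAt Y x) :
    mvfderiv 𝓘(ℝ, E) (fun y => leeLin D y (Y y)) x v = leeLin D x (D' Y x v) := by
  rw [hB.mvfderiv_leeLin v h0 hY, hB.leviCivita_eq hL hY, map_sub, map_smul,
    hB.leeLin_torsion hg h2, smul_zero, sub_zero]

/-- If the Bismut connection of a complex surface satisfies the first Bianchi identity and has
closed torsion, then the metric is Vaisman. -/
theorem IsBismut.isVaisman (hB : IsBismut g D) (hg : IsHermitian g)
    (h2 : Module.finrank ℂ E = 2) (hL : IsLeviCivita g D') (hBi : FirstBianchi D)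
    (hd : d (torsionForm hB) = 0) : IsVaisman hg hL := by
  have h0 := fun x => (hB.covTorsion_eq_zero_of_closed hBi hd x).1
  have hpar : ∀ {x : M} (v : TangentSpace 𝓘(ℝ, E) x) {Y : VField E M}, DiffAt Y x →
      mvfderiv 𝓘(ℝ, E) (fun y => leeLin D y (Y y)) x v = leeLin D x (D' Y x v) := fun v _ hY =>
    hB.mvfderiv_leeLin_leviCivita hg h2 hL v (h0 _ v) hY
  refine ⟨leeForm D, isSmoothForm_of_components fun x₀ y hy => smoothComponents_leeForm hB.smooth hy,
    ?_, hB.d_fundamentalForm_eq_wedge hg h2, ?_⟩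
  · funext x
    ext v
    rw [d_apply_coordExt (smoothComponents_leeForm hB.smooth (mem_chart_source E x))]
    refine (Fin.sum_univ_two _).trans ?_
    have h : ∀ p q : ℝ, p = q → (-1 : ℤ) ^ 0 • p + (-1 : ℤ) ^ 1 • q = 0 := by
      rintro p q rfl
      norm_num
    -- Since `θ` is parallel, `dθ(v₀, v₁)` is `θ` of the torsion of the Levi-Civita connection,
    -- which vanishes.
    refine h _ _ (((hpar (v 0) (diffAt_coordExt (v 1))).trans (congrArg (leeLin D x) ?_)).trans
      (hpar (v 1) (diffAt_coordExt (v 0))).symm)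
    have ht := torsion_eq_cov_sub D' x (v 0) (v 1)
    rw [hL.torsion] at ht
    exact sub_eq_zero.1 ht.symm
  · intro x Y hY v
    rw [Fin.sum_univ_one, sub_eq_zero]
    simp only [leeForm_apply, Function.update_self]
    exact hpar v (hY 0)

end LeeForm

end Hermitian

end

theorem mainTheorem9
    {E : Type*} [NormedAddCommGroup E] [NormedSpace ℂ E] [FiniteDimensional ℂ E]
    {M : Type*} [TopologicalSpace M] [T2Space M] [ChartedSpace E M] [IsManifold 𝓘(ℂ, E) ω M]
    (g : Hermitian.Metric E M) (hg : Hermitian.IsHermitian g)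
    (DB : Hermitian.Connection E M) (hB : Hermitian.IsBismut g DB)
    (DLC : Hermitian.Connection E M) (hLC : Hermitian.IsLeviCivita g DLC)
    (hBianchi : Hermitian.FirstBianchi DB) :
    (Hermitian.IsSKT hB → Hermitian.IsParallel DLC (Hermitian.torsionForm hB)) ∧
    (Module.finrank ℂ E = 2 → Hermitian.IsGauduchon hg → Hermitian.IsVaisman hg hLC) := by
  exact ⟨fun h => hB.isParallel_torsionForm hBianchi h hLC,
    fun h2 h => hB.isVaisman hg h2 hLC hBianchi (hB.d_torsionForm_of_isGauduchon hg h2 h)⟩
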